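/- Let $p>q$ be prime numbers, let $e$ be the least positive integer with $p^e\equiv 1\pmod q$, let $g\ge 1$ be an integer and $n=gq+1$, and assume $p^e>n$ and $p\ge n+q-2$. For $s\ge 1$ put $$\Phi_s(t,z)=\big((t-z_1)\cdots(t-z_n)\big)^{(p^{es}-1)/q}\in\mathbb Z[z_1,\dots,z_n][t].$$ Let $A(\Phi_s)$ be the $g\times g$ matrix whose $(u,v)$ entry is the coefficient of $t^{p^{es}v-u}$ in $\Phi_s(t,z)$, $u,v=1,\dots,g$, and let $I_s(z)$ be the $n\times g$ matrix whose entry in row $k$ and column $\ell$ is the coefficient of $t^{\ell p^{es}-1}$ in the polynomial $\Phi_s(t,z)/(t-z_k)$. Let $m\ge1$, let $\mathbb Q_p^{(m)}$ be the unramified extension of $\mathbb Q_p$ of degree $m$ in a fixed algebraic closure of $\mathbb Q_p$, generated by the roots of unity of order dividing $p^m-1$, with the extended norm $|\cdot|_p$, and let $\mathbb Z_p^{(m)}$ be its ring of integers. Put $$\mathfrak D^{(m)}_{\mathrm{KZ}}=\{a\in(\mathbb Z_p^{(m)})^n \;:\; |\det A(\Phi_1)(a)|_p=1\}.$$ For $i\neq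 j$ let $\Omega_{ij}$ be the $n\times n$ matrix with entries $-1$ at $(i,i)$ and $(j,j)$, entries $1$ at $(i,j)$ and $(j,i)$, and all other entries $0$, and let $$H_i(z)=\frac1q\sum_{j\ne i}\frac{\Omega_{ij}}{z_i-z_j},\qquad i=1,\dots,n,$$ be the Gaudin Hamiltonians. Then, as $s\to\infty$, the sequence $I_s(z)\,A(\Phi_s)(z)^{-1}$ and, for every $i=1,\dots,n$, the sequence $\frac{\partial I_s}{\partial z_i}(z)\,A(\Phi_s)(z)^{-1}$ converge uniformly on $\mathfrak D^{(m)}_{\mathrm{KZ}}$ to $n\times g$ matrices $\mathcal I(z)$ and $\mathcal I^{(i)}(z)$ with entries in $\mathbb Q_p^{(m)}$, and these limits satisfy on $\mathfrak D^{(m)}_{\mathrm{KZ}}$ the equations $$\mathcal I^{(i)}=H_i\cdot\mathcal I,\qquad i=1,\dots,n.$$ That is, the $i$-th equation holds at every point $a\in\mathfrak D^{(m)}_{\mathrm{KZ}}$ with $a_i\ne a_j$ for all $j\neq i$ (where $H_i$ is defined), and the equation obtained from it by multiplying both sides by $\prod_{j\neq i}(z_i-z_j)$, $$\prod_{j\neq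 i}(a_i-a_j)\cdot\mathcal I^{(i)}(a)=\frac1q\sum_{j\ne i}\Big(\prod_{k\neq i,j}(a_i-a_k)\Big)\,\Omega_{ij}\,\mathcal I(a),$$ holds at every point $a\in\mathfrak D^{(m)}_{\mathrm{KZ}}$. -/

import Mathlib

open Polynomial Filter

noncomputable section

/-- The unramified extension `ℚ_p^{(m)}` of `ℚ_p` of degree `m ≥ 1` inside the fixed algebraic closure
`PadicAlgCl p` of `ℚ_p`: it is generated by the roots of unity of order dividing `p ^ m - 1`.
It carries the restriction of the `p`-adic norm of `PadicAlgCl p`. -/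
def UnramifiedExt (p : ℕ) [Fact p.Prime] (m : ℕ) : IntermediateField ℚ_[p] (PadicAlgCl p) :=
  IntermediateField.adjoin ℚ_[p] {x | x ^ (p ^ m - 1) = 1}

/-- The least positive integer `e` with `p ^ e ≡ 1 (mod q)` (for distinct primes `p`, `q`). -/
def expOrder (p q : ℕ) : ℕ := orderOf (p : ZMod q)

/-- The master polynomial `Φ_s(t,z) = ((t - z_1) ⋯ (t - z_n)) ^ ((p ^ (e s) - 1) / q)`, as a polynomial
in `t` whose coefficients are polynomials in `z` over `ℤ`. -/
def masterPoly (n p q s : ℕ) : (MvPolynomial (Fin n) ℤ)[X] :=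
  (∏ i : Fin n, (X - C (MvPolynomial.X i))) ^ ((p ^ (expOrder p q * s) - 1) / q)

/-- The Hasse--Witt matrix `A(Φ_s)`, with entries `Coeff_{p ^ (e s) v - u} Φ_s(t,z)` for
`u, v = 1, …, g` (the indices of `Fin g` are shifted by one). -/
def hasseWitt (n g p q s : ℕ) : Matrix (Fin g) (Fin g) (MvPolynomial (Fin n) ℤ) :=
  Matrix.of fun u v =>
    (masterPoly n p q s).coeff (p ^ (expOrder p q * s) * ((v : ℕ) + 1) - ((u : ℕ) + 1))

/-- The `n × g` matrix `I_s(z)` whose entry in row `i` and column `ℓ` is the coefficient of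
`t ^ (ℓ p ^ (e s) - 1)` in the polynomial `Φ_s(t,z) / (t - z_i)` (an exact division for `s ≥ 1`).
Its columns are the `p ^ (e s)`-hypergeometric solutions. -/
def hypergeomSol (n g p q s : ℕ) : Matrix (Fin n) (Fin g) (MvPolynomial (Fin n) ℤ) :=
  Matrix.of fun i l =>
    (masterPoly n p q s /ₘ (X - C (MvPolynomial.X i))).coeff
      (((l : ℕ) + 1) * p ^ (expOrder p q * s) - 1)

/-- The value at `z = a` of a matrix of polynomials in `z`. -/
def evalMatrix {n : ℕ} {ι κ K : Type*} [Field K] (a : Fin n → K)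
    (M : Matrix ι κ (MvPolynomial (Fin n) ℤ)) : Matrix ι κ K :=
  M.map (MvPolynomial.aeval a)

/-- The entrywise partial derivative `∂M/∂z_i` of a matrix of polynomials in `z`. -/
def pderivMatrix {n : ℕ} {ι κ : Type*} (i : Fin n)
    (M : Matrix ι κ (MvPolynomial (Fin n) ℤ)) : Matrix ι κ (MvPolynomial (Fin n) ℤ) :=
  M.map (MvPolynomial.pderiv i)

/-- The domain `𝔇_KZ^{(m)}` of all `a ∈ (ℤ_p^{(m)})^n` with `|det A(Φ_1(t,a))|_p = 1`. -/
def domainKZ (n g p q : ℕ) [Fact p.Prime] (m : ℕ) : Set (Fin n → UnramifiedExt p m) :=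
  {a | (∀ i, ‖a i‖ ≤ 1) ∧ ‖(evalMatrix a (hasseWitt n g p q 1)).det‖ = 1}

/-- The matrix `Ω_{ij}`, for `i ≠ j`: entries `-1` at `(i,i)` and `(j,j)`, entries `1` at `(i,j)` and
`(j,i)`, all other entries zero. -/
def Omega {n : ℕ} (K : Type*) [Field K] (i j : Fin n) : Matrix (Fin n) (Fin n) K :=
  Matrix.single i j 1 + Matrix.single j i 1 - Matrix.single i i 1 - Matrix.single j j 1

/-- The Gaudin Hamiltonian `H_i(a) = (1/q) ∑_{j ≠ i} Ω_{ij} / (a_i - a_j)`, meaningful when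
`a_i ≠ a_j` for all `j ≠ i`. -/
def gaudinH {n : ℕ} {K : Type*} [Field K] (q : ℕ) (i : Fin n) (a : Fin n → K) :
    Matrix (Fin n) (Fin n) K :=
  (q : K)⁻¹ • ∑ j ∈ Finset.univ.erase i, (a i - a j)⁻¹ • Omega K i j

end

/-! Write `F = ∏ (t - a_j)`, `P_k = F / (t - a_k)`, `Q = p^e` and `M_s = (Q^s - 1)/q`. Every
quantity at level `s` is a row of coefficients of `t^(l Q^s - 1)` in `E F^(M_s - 2)`, with `E` a
polynomial of bounded degree independent of `s` up to a scalar: `E = t^u F^2` gives the Hasse–Witt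
matrix, `E = F P_k` gives `I_s`, and `E = (δ_ik - M_s) P_i P_k` gives `∂I_s/∂z_i`. Multiplying such
a row by the inverse Hasse–Witt matrix gives its normalized form.

Convergence is a Dwork congruence. Since `M_(s+1) = M_s + M_1 Q^s`, passing to level `s + 1`
multiplies by a `Q^s`-th power, and modulo `p^s` this changes all rows by one matrix not depending
on `E` (`repMod_cartier_mul_pow`). The Hasse–Witt matrix changes by the same matrix, which cancels,
so normalized rows at consecutive levels agree modulo `p^s` (`normalizedRow_succ_sub_dvd`). The
Hasse–Witt determinants remain units because modulo `p` the matrix at level `s + 1` is the one at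
level `s` times a Frobenius twist of the one at level 1 (`isUnit_det_hwMatrix`). The bound `|p|^s`
does not depend on the point, hence uniformity.

For the equations, let `J_k` be the limit for `E = P_i P_k`. Partial fractions give `I_i - I_k =
(a_i - a_k) J_k`. As `M_s → -1/q`, also `I'_k = J_k / q` for `k ≠ i`. The derivative in `t` of `P_i
F^(M_s - 1)` has its relevant coefficients divisible by `Q^s`, so it vanishes in the limit and
yields `I'_i = -(1/q) ∑_{j ≠ i} J_j`. These three relations are the KZ equations
(`kz_of_relations`); as `J_k` exists even when `a_i = a_k`, they also give the form without
denominators. -/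

/-! ### Cartier operators on polynomials -/

section CartierOperator

variable {R : Type*} [CommRing R]

/-- The operator sending `∑ c_k t ^ k` to `∑ c_{mN-1} t ^ m`. -/
noncomputable def cartier (N : ℕ) (f : R[X]) : R[X] := contract N (X * f)

theorem coeff_cartier {N : ℕ} (hN : N ≠ 0) (f : R[X]) (m : ℕ) :
    (cartier N f).coeff m = (X * f).coeff (m * N) := coeff_contract hN _ _

theorem coeff_cartier_zero {N : ℕ} (hN : N ≠ 0) (f : R[X]) : (cartier N f).coeff 0 = 0 := by
  simp [coeff_cartier hN]

theorem coeff_cartier_succ {N : ℕ} (hN : N ≠ 0) (f : R[X]) (m : ℕ) :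
    (cartier N f).coeff (m + 1) = f.coeff ((m + 1) * N - 1) := by
  have h : (m + 1) * N = ((m + 1) * N - 1) + 1 :=
    (Nat.succ_pred (Nat.mul_ne_zero m.succ_ne_zero hN)).symm
  rw [coeff_cartier hN]
  conv_lhs => rw [h]
  rw [coeff_X_mul]

theorem cartier_mul_expand {N : ℕ} (hN : N ≠ 0) (f h : R[X]) :
    cartier N (f * expand R N h) = cartier N f * h := by
  rw [cartier, ← mul_assoc, contract_mul_expand hN, cartier]

theorem cartier_add {N : ℕ} (hN : N ≠ 0) (f h : R[X]) :
    cartier N (f + h) = cartier N f + cartier N h := by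
  rw [cartier, mul_add, contract_add hN, cartier, cartier]

theorem cartier_C_mul {N : ℕ} (hN : N ≠ 0) (c : R) (f : R[X]) :
    cartier N (C c * f) = C c * cartier N f := by
  ext m; simp [coeff_cartier hN, mul_left_comm X]

theorem contract_C_mul {N : ℕ} (hN : N ≠ 0) (c : R) (f : R[X]) :
    contract N (C c * f) = C c * contract N f := by
  ext m; simp [coeff_contract hN]

theorem contract_sub {N : ℕ} (hN : N ≠ 0) (f h : R[X]) :
    contract N (f - h) = contract N f - contract N h := by
  ext m; simp [coeff_contract hN]

theorem contract_sum {N : ℕ} (hN : N ≠ 0) {ι : Type*} (s : Finset ι) (f : ι → R[X]) :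
    contract N (∑ i ∈ s, f i) = ∑ i ∈ s, contract N (f i) := by
  ext m; simp [coeff_contract hN, finsetSum_coeff]

/-- The shift by one in the index occurs only once: coefficient `m M` of the Cartier image is the
one at `m M N - 1`, so later steps are plain contractions. -/
theorem contract_cartier {N M : ℕ} (hN : N ≠ 0) (hM : M ≠ 0) (f : R[X]) :
    contract M (cartier N f) = cartier (N * M) f := by
  ext m
  rw [coeff_contract hM, coeff_cartier hN, coeff_cartier (Nat.mul_ne_zero hN hM)]
  ring_nf

theorem natCast_pow_eq_C (p k : ℕ) : (p : R[X]) ^ k = C ((p : R) ^ k) := by simp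

theorem pow_dvd_contract {N : ℕ} (hN : N ≠ 0) {p k : ℕ} {f : R[X]} (h : (p : R[X]) ^ k ∣ f) :
    (p : R[X]) ^ k ∣ contract N f := by
  obtain ⟨f', rfl⟩ := h
  rw [natCast_pow_eq_C, contract_C_mul hN]
  exact dvd_mul_right _ _

end CartierOperator

/-! ### Divisibility of the coefficients of `p`-power powers -/

section Divisibility

variable {R : Type*} [CommRing R] {p : ℕ}

/-- Write `k = p^a b` with `a ≤ v` and `b` prime to `p`: the factor `p^a` cancels by
torsion-freeness, and `b` is coprime to powers of `p` in `R`. -/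
theorem pow_dvd_of_pow_dvd_natCast_mul (hp : p.Prime) (htf : ∀ x : R, (p : R) * x = 0 → x = 0)
    {N v k : ℕ} {c : R} (hv : v ≤ N) (hk : ¬ p ^ (v + 1) ∣ k) (h : (p : R) ^ N ∣ (k : R) * c) :
    (p : R) ^ (N - v) ∣ c := by
  have hk0 : k ≠ 0 := by rintro rfl; exact hk (dvd_zero _)
  obtain ⟨a, b, hb, rfl⟩ := Nat.exists_eq_pow_mul_and_not_dvd hk0 p hp.ne_one
  have hav : a ≤ v := by
    by_contra hlt
    exact hk ((pow_dvd_pow p (by omega)).trans (dvd_mul_right _ _))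
  have htf' : ∀ (n : ℕ) (x : R), (p : R) ^ n * x = 0 → x = 0 := by
    intro n
    induction n with
    | zero => intro x hx; simpa using hx
    | succ n ih => intro x hx; exact ih x (htf _ (by rw [← hx]; ring))
  obtain ⟨d, hd⟩ := h
  have h1 : (b : R) * c = (p : R) ^ (N - a) * d := by
    have : (p : R) ^ a * ((b : R) * c - (p : R) ^ (N - a) * d) = 0 := by
      rw [mul_sub, ← mul_assoc, ← mul_assoc, ← pow_add, Nat.add_sub_cancel' (hav.trans hv), ← hd]
      push_cast; ring
    exact sub_eq_zero.1 (htf' _ _ this)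
  have hcop : IsCoprime ((p : R) ^ (N - a)) (b : R) := by
    have h2 : Nat.Coprime (p ^ (N - a)) b := Nat.Coprime.pow_left _ ((hp.coprime_iff_not_dvd).2 hb)
    have := (Nat.isCoprime_iff_coprime.2 h2).map (Int.castRingHom R)
    simpa using this
  exact (pow_dvd_pow _ (by omega)).trans (hcop.dvd_of_dvd_mul_left ⟨d, h1⟩)

/-- The derivative of `H^(p^N)` is divisible by `p^N`. -/
theorem pow_dvd_natCast_mul_coeff_pow (H : R[X]) (N k : ℕ) :
    (p : R) ^ N ∣ (k : R) * (H ^ (p ^ N)).coeff k := by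
  rcases k with _ | k
  · simp
  have h : derivative (H ^ (p ^ N)) = C ((p : R) ^ N) * (H ^ (p ^ N - 1) * derivative H) := by
    rw [derivative_pow]; simp [mul_assoc]
  have h2 := congrArg (fun f => f.coeff k) h
  simp only [coeff_derivative, coeff_C_mul] at h2
  exact ⟨_, by rw [mul_comm]; push_cast; exact h2⟩

/-- Every monomial of `H ^ (Q ^ j)` is `p ^ (j - i)` times a polynomial in `t ^ (Q ^ i)` for some
`i ≤ j`. -/
theorem monomial_coeff_pow_eq (hp : p.Prime) (htf : ∀ x : R, (p : R) * x = 0 → x = 0)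
    {e : ℕ} (he : 0 < e) (H : R[X]) (j k : ℕ) :
    ∃ i ≤ j, ∃ G : R[X], monomial k ((H ^ ((p ^ e) ^ j)).coeff k) =
      C ((p : R) ^ (j - i)) * expand R ((p ^ e) ^ i) G := by
  classical
  set c := (H ^ ((p ^ e) ^ j)).coeff k with hc
  let P : ℕ → Prop := fun i => (p ^ e) ^ i ∣ k
  set i := Nat.findGreatest P j with hi
  have hij : i ≤ j := Nat.findGreatest_le j
  have hPi : P i := Nat.findGreatest_spec (P := P) (m := 0) (Nat.zero_le j) (by simp [P])
  have hdvd : (p : R) ^ (j - i) ∣ c := by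
    rcases hij.eq_or_lt with h | h
    · simp [h]
    · have hn : ¬ P (i + 1) := Nat.findGreatest_is_greatest (P := P) (Nat.lt_succ_self i) h
      have h1 : (p : R) ^ (e * j) ∣ (k : R) * c := by
        rw [hc, ← pow_mul]; exact pow_dvd_natCast_mul_coeff_pow H (e * j) k
      have hle : e * (i + 1) ≤ e * j := Nat.mul_le_mul_left e h
      have hpos : 0 < e * (i + 1) := Nat.mul_pos he i.succ_pos
      -- Since `p^(e(i+1))` does not divide `k`, at most `e(i+1) - 1` factors `p` are lost, and `e j
      -- - e(i+1) + 1 ≥ j - i`.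
      have h2 := pow_dvd_of_pow_dvd_natCast_mul hp htf (v := e * (i + 1) - 1) (by omega)
        (by rw [Nat.sub_add_cancel hpos, pow_mul]; exact hn) h1
      refine (pow_dvd_pow _ ?_).trans h2
      have h3 : 1 * (j - (i + 1)) ≤ e * (j - (i + 1)) := Nat.mul_le_mul_right _ he
      rw [Nat.mul_sub e] at h3
      omega
  obtain ⟨d, hd⟩ := hdvd
  obtain ⟨k', hk'⟩ := hPi
  refine ⟨i, hij, monomial k' d, ?_⟩
  rw [expand_monomial, C_mul_monomial, ← hd, mul_comm k', ← hk']

end Divisibility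

/-! ### Dwork congruences -/

section Congruence

variable {R : Type*} [CommRing R] {W : Type*} {g : ℕ}

/-- From `A C B = 1`, square matrices give `C (B A) = 1`; invertibility of `A` need not be assumed.
-/
theorem vecMul_inv_mul_of_eq {S : Type*} [CommRing S] {A A' B C : Matrix (Fin g) (Fin g) S}
    {v v' : Fin g → S} (hA : A' = A * C) (hv : v' = Matrix.vecMul v C) (hB : A' * B = 1) :
    Matrix.vecMul v' (B * A) = v := by
  have h : C * (B * A) = 1 := by
    rw [← mul_assoc]
    refine mul_eq_one_comm.1 ?_
    rw [← mul_assoc, ← hA, hB]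
  rw [hv, Matrix.vecMul_vecMul, h, Matrix.vecMul_one]

/-- The coefficients of `t ^ (N - 1), …, t ^ (gN - 1)`. -/
noncomputable def cartierVec (g N : ℕ) (f : R[X]) : Fin g → R :=
  fun l => (cartier N f).coeff ((l : ℕ) + 1)

theorem cartier_eq_sum {N : ℕ} (hN : N ≠ 0) {f : R[X]} (hf : (cartier N f).natDegree ≤ g) :
    cartier N f = ∑ l : Fin g, C (cartierVec g N f l) * X ^ ((l : ℕ) + 1) := by
  conv_lhs => rw [(cartier N f).as_sum_range' (g + 1) (by omega)]
  rw [Finset.sum_range_succ', coeff_cartier_zero hN, monomial_zero_right, add_zero,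
    Finset.sum_range]
  simp [cartierVec, C_mul_X_pow_eq_monomial]

/-- The family of polynomials `Y` is modulo `p ^ k` a fixed combination of the entries of the family
of vectors `v`. -/
def RepMod (p : ℕ) (v : W → Fin g → R) (k : ℕ) (Y : W → R[X]) : Prop :=
  ∃ D : Fin g → R[X], ∀ w, (p : R[X]) ^ k ∣ Y w - ∑ l, C (v w l) * D l

namespace RepMod

variable {p k : ℕ} {v : W → Fin g → R} {Y Z : W → R[X]}

theorem of_dvd (h : ∀ w, (p : R[X]) ^ k ∣ Y w) : RepMod p v k Y :=
  ⟨0, fun w => by simpa using h w⟩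

theorem add (hY : RepMod p v k Y) (hZ : RepMod p v k Z) : RepMod p v k (fun w => Y w + Z w) := by
  obtain ⟨D, hD⟩ := hY
  obtain ⟨D', hD'⟩ := hZ
  refine ⟨D + D', fun w => ?_⟩
  convert (hD w).add (hD' w) using 1
  simp only [Pi.add_apply, mul_add, Finset.sum_add_distrib]
  ring

theorem sum {ι : Type*} (s : Finset ι) {Y : ι → W → R[X]} (h : ∀ i ∈ s, RepMod p v k (Y i)) :
    RepMod p v k (fun w => ∑ i ∈ s, Y i w) := by
  classical
  induction s using Finset.induction_on with
  | empty => exact of_dvd fun w => by simp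
  | insert a s ha ih =>
    simp only [Finset.sum_insert ha]
    exact (h a (Finset.mem_insert_self a s)).add
      (ih fun i hi => h i (Finset.mem_insert_of_mem hi))

theorem mul_right (hY : RepMod p v k Y) (G : R[X]) : RepMod p v k (fun w => Y w * G) := by
  obtain ⟨D, hD⟩ := hY
  refine ⟨fun l => D l * G, fun w => ?_⟩
  convert (hD w).mul_right G using 1
  rw [sub_mul, Finset.sum_mul]
  simp only [mul_assoc]

theorem contract {N : ℕ} (hN : N ≠ 0) (hY : RepMod p v k Y) :
    RepMod p v k (fun w => Polynomial.contract N (Y w)) := by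
  obtain ⟨D, hD⟩ := hY
  refine ⟨fun l => Polynomial.contract N (D l), fun w => ?_⟩
  convert pow_dvd_contract hN (hD w) using 1
  rw [contract_sub hN, contract_sum hN]
  simp only [contract_C_mul hN]

theorem pow_mul (hY : RepMod p v k Y) (a : ℕ) :
    RepMod p v (a + k) (fun w => C ((p : R) ^ a) * Y w) := by
  obtain ⟨D, hD⟩ := hY
  refine ⟨fun l => C ((p : R) ^ a) * D l, fun w => ?_⟩
  rw [pow_add, natCast_pow_eq_C p a]
  convert mul_dvd_mul_left (C ((p : R) ^ a)) (hD w) using 1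
  rw [mul_sub, Finset.mul_sum]
  simp only [mul_left_comm]

theorem change {v' : W → Fin g → R} (B : Matrix (Fin g) (Fin g) R)
    (hB : ∀ w l, (p : R) ^ k ∣ v w l - Matrix.vecMul (v' w) B l) (hY : RepMod p v k Y) :
    RepMod p v' k Y := by
  obtain ⟨D, hD⟩ := hY
  refine ⟨fun m => ∑ l, C (B m l) * D l, fun w => ?_⟩
  have h : (p : R[X]) ^ k ∣ ∑ l, C (v w l - Matrix.vecMul (v' w) B l) * D l := by
    refine Finset.dvd_sum fun l _ => Dvd.dvd.mul_right ?_ _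
    rw [natCast_pow_eq_C]
    exact _root_.map_dvd C (hB w l)
  convert (hD w).add h using 1
  simp only [C_sub, sub_mul, Finset.sum_sub_distrib, Matrix.vecMul, dotProduct, map_sum,
    Finset.sum_mul, Finset.mul_sum, C_mul]
  rw [Finset.sum_comm]
  simp only [mul_assoc]
  ring

theorem exists_matrix {N : ℕ} {f : W → R[X]} (h : RepMod p v k fun w => cartier N (f w)) :
    ∃ B : Matrix (Fin g) (Fin g) R, ∀ w l,
      (p : R) ^ k ∣ cartierVec g N (f w) l - Matrix.vecMul (v w) B l := by
  obtain ⟨D, hD⟩ := h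
  refine ⟨Matrix.of fun m l => (D m).coeff ((l : ℕ) + 1), fun w l => ?_⟩
  have h1 := hD w
  rw [natCast_pow_eq_C, C_dvd_iff_dvd_coeff] at h1
  convert h1 ((l : ℕ) + 1) using 1
  simp [cartierVec, Matrix.vecMul, dotProduct, finsetSum_coeff]

end RepMod

theorem dvd_sub_iff_quotient (x a b : R) :
    x ∣ a - b ↔ Ideal.Quotient.mk (Ideal.span {x}) a = Ideal.Quotient.mk (Ideal.span {x}) b := by
  rw [Ideal.Quotient.mk_eq_mk_iff_sub_mem, Ideal.mem_span_singleton]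

theorem map_eq_vecMul_map {x : R} {v v' : Fin g → R} {B : Matrix (Fin g) (Fin g) R}
    (h : ∀ l, x ∣ v' l - Matrix.vecMul v B l) :
    (fun l => Ideal.Quotient.mk (Ideal.span {x}) (v' l)) =
      Matrix.vecMul (fun l => Ideal.Quotient.mk (Ideal.span {x}) (v l))
        (B.map (Ideal.Quotient.mk (Ideal.span {x}))) := by
  funext l
  rw [(dvd_sub_iff_quotient _ _ _).1 (h l)]
  simp [Matrix.vecMul, dotProduct]

variable {p : ℕ}

/-- If two families of vectors are related modulo `x` by a fixed matrix, and a subfamily of the second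
one forms an invertible matrix, then the families are proportional modulo `x` to that subfamily. -/
theorem exists_change_of_matrix {x : R} {v v' : W → Fin g → R} (w₀ : Fin g → W)
    {B : Matrix (Fin g) (Fin g) R} (h : ∀ w l, x ∣ v' w l - Matrix.vecMul (v w) B l)
    (hA : IsUnit (Matrix.of fun u => v' (w₀ u)).det) :
    ∀ w l, x ∣ v w l - Matrix.vecMul (v' w)
      ((Matrix.of fun u => v' (w₀ u))⁻¹ * (Matrix.of fun u => v (w₀ u))) l := by
  intro w l
  set A' : Matrix (Fin g) (Fin g) R := Matrix.of fun u => v' (w₀ u) with hA'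
  set A : Matrix (Fin g) (Fin g) R := Matrix.of fun u => v (w₀ u) with hAdef
  set π := Ideal.Quotient.mk (Ideal.span {x}) with hπ
  have h1 : A'.map π = A.map π * B.map π := by
    ext u l
    have := congrFun (map_eq_vecMul_map (h (w₀ u))) l
    simpa [Matrix.mul_apply, Matrix.vecMul, dotProduct, hA', hAdef, hπ] using this
  have h2 : A'.map π * A'⁻¹.map π = 1 := by
    rw [← Matrix.map_mul, Matrix.mul_nonsing_inv _ hA, Matrix.map_one _ (map_zero π) (map_one π)]
  have h3 := congrFun (vecMul_inv_mul_of_eq h1 (map_eq_vecMul_map (h w)) h2) l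
  rw [dvd_sub_iff_quotient, ← h3, ← Matrix.map_mul]
  simp [Matrix.vecMul, dotProduct, hπ]

/-- Modulo `x` the rows and the distinguished matrix are multiplied by the same `B`, which cancels
in the normalized row. -/
theorem vecMul_inv_sub_dvd {x : R} {v v' : W → Fin g → R} (w₀ : Fin g → W)
    {B : Matrix (Fin g) (Fin g) R} (h : ∀ w l, x ∣ v' w l - Matrix.vecMul (v w) B l)
    (hA : IsUnit (Matrix.of fun u => v (w₀ u)).det)
    (hA' : IsUnit (Matrix.of fun u => v' (w₀ u)).det) (w : W) (l : Fin g) :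
    x ∣ Matrix.vecMul (v' w) (Matrix.of fun u => v' (w₀ u))⁻¹ l -
      Matrix.vecMul (v w) (Matrix.of fun u => v (w₀ u))⁻¹ l := by
  have h1 := exists_change_of_matrix w₀ h hA' w
  set A' : Matrix (Fin g) (Fin g) R := Matrix.of fun u => v' (w₀ u)
  set A : Matrix (Fin g) (Fin g) R := Matrix.of fun u => v (w₀ u)
  have h2 : ∀ l, x ∣ (v w - Matrix.vecMul (v' w) (A'⁻¹ * A)) l := h1
  have h3 : x ∣ Matrix.vecMul (v w - Matrix.vecMul (v' w) (A'⁻¹ * A)) A⁻¹ l := by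
    simp only [Matrix.vecMul, dotProduct]
    exact Finset.dvd_sum fun m _ => (h2 m).mul_right _
  rw [Matrix.sub_vecMul, Matrix.vecMul_vecMul, mul_assoc, Matrix.mul_nonsing_inv _ hA,
    mul_one] at h3
  rw [← dvd_neg]
  simpa using h3

/-- Dwork congruences, in the form of a fixed linear dependence modulo `p ^ j`. -/
theorem repMod_cartier_mul_pow (hp : p.Prime) (htf : ∀ x : R, (p : R) * x = 0 → x = 0)
    {e : ℕ} (he : 0 < e) (Φ : ℕ → R[X]) (f : W → ℕ → R[X])
    (hf : ∀ w i k, 1 ≤ i → f w (i + k) = f w i * Φ k ^ ((p ^ e) ^ i))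
    (hdeg : ∀ w i, 1 ≤ i → (cartier ((p ^ e) ^ i) (f w i)).natDegree ≤ g)
    (w₀ : Fin g → W)
    (hA : ∀ i, 1 ≤ i →
      IsUnit (Matrix.of fun u => cartierVec g ((p ^ e) ^ i) (f (w₀ u) i)).det)
    (j : ℕ) (hj : 1 ≤ j) (H : R[X]) :
    RepMod p (fun w => cartierVec g ((p ^ e) ^ j) (f w j)) j
      (fun w => cartier ((p ^ e) ^ j) (f w j * H ^ ((p ^ e) ^ j))) := by
  induction j using Nat.strong_induction_on generalizing H with
  | _ j ih =>
  have hQ : ∀ i, (p ^ e) ^ i ≠ 0 := fun i => pow_ne_zero _ (pow_ne_zero _ hp.ne_zero)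
  have key : ∀ i ≤ j, ∀ G : R[X], RepMod p (fun w => cartierVec g ((p ^ e) ^ j) (f w j)) j
      (fun w => cartier ((p ^ e) ^ j)
        (f w j * (C ((p : R) ^ (j - i)) * expand R ((p ^ e) ^ i) G))) := by
    intro i hi G
    have hcomm : ∀ w, cartier ((p ^ e) ^ j)
        (f w j * (C ((p : R) ^ (j - i)) * expand R ((p ^ e) ^ i) G)) =
        C ((p : R) ^ (j - i)) * contract ((p ^ e) ^ (j - i)) (cartier ((p ^ e) ^ i) (f w j) * G) := by
      intro w
      rw [mul_left_comm, cartier_C_mul (hQ j), ← cartier_mul_expand (hQ i),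
        contract_cartier (hQ i) (hQ (j - i)), ← pow_add, Nat.add_sub_cancel' hi]
    simp only [hcomm]
    -- The factor `p^(j - i)` makes up for working only modulo `p^i`.
    suffices h : RepMod p (fun w => cartierVec g ((p ^ e) ^ j) (f w j)) i
        (fun w => cartier ((p ^ e) ^ i) (f w j)) by
      have h2 := (((h.mul_right G).contract (hQ (j - i))).pow_mul (j - i))
      rwa [Nat.sub_add_cancel hi] at h2
    rcases Nat.eq_zero_or_pos i with rfl | hi0
    · exact RepMod.of_dvd fun w => by simp
    rcases hi.eq_or_lt with rfl | hlt
    -- At `i = j` the degree bound leaves only `g` coefficients, so the combination is exact.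
    · refine ⟨fun l => X ^ ((l : ℕ) + 1), fun w => ?_⟩
      dsimp only
      rw [← cartier_eq_sum (hQ i) (hdeg w i hj), sub_self]
      exact dvd_zero _
    have hfij : ∀ w, f w j = f w i * Φ (j - i) ^ ((p ^ e) ^ i) := by
      intro w
      rw [← hf w i (j - i) hi0, Nat.add_sub_cancel' hi]
    have h1 : RepMod p (fun w => cartierVec g ((p ^ e) ^ i) (f w i)) i
        (fun w => cartier ((p ^ e) ^ i) (f w j)) := by
      simp only [hfij]
      exact ih i hlt hi0 (Φ (j - i))
    have h2 := h1.contract (hQ (j - i))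
    simp only [contract_cartier (hQ i) (hQ (j - i)), ← pow_add, Nat.add_sub_cancel' hi] at h2
    obtain ⟨B, hB⟩ := h2.exists_matrix
    -- The induction hypothesis uses the vectors of level `i`. Contracting it relates them to those
    -- of level `j` modulo `p^i`, and invertibility at level `j` allows this relation to be
    -- reversed.
    exact h1.change _ (exists_change_of_matrix w₀ hB (hA j hj))
  have hsum : ∀ w, cartier ((p ^ e) ^ j) (f w j * H ^ ((p ^ e) ^ j)) =
      ∑ k ∈ (H ^ ((p ^ e) ^ j)).support, cartier ((p ^ e) ^ j)
        (f w j * monomial k ((H ^ ((p ^ e) ^ j)).coeff k)) := by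
    intro w
    conv_lhs => rw [(H ^ ((p ^ e) ^ j)).as_sum_support]
    rw [Finset.mul_sum]
    simp only [cartier]
    rw [Finset.mul_sum, contract_sum (hQ j)]
  simp only [hsum]
  refine RepMod.sum _ fun k _ => ?_
  obtain ⟨i, hi, G, hG⟩ := monomial_coeff_pow_eq hp htf he H j k
  simp only [hG]
  exact key i hi G

/-- Level `s + 1` is the preceding congruence with `H = Φ 1`, contracted once more by `p^e`. -/
theorem vecMul_inv_succ_sub_dvd (hp : p.Prime) (htf : ∀ x : R, (p : R) * x = 0 → x = 0)
    {e : ℕ} (he : 0 < e) (Φ : ℕ → R[X]) (f : W → ℕ → R[X])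
    (hf : ∀ w i k, 1 ≤ i → f w (i + k) = f w i * Φ k ^ ((p ^ e) ^ i))
    (hdeg : ∀ w i, 1 ≤ i → (cartier ((p ^ e) ^ i) (f w i)).natDegree ≤ g)
    (w₀ : Fin g → W)
    (hA : ∀ i, 1 ≤ i →
      IsUnit (Matrix.of fun u => cartierVec g ((p ^ e) ^ i) (f (w₀ u) i)).det)
    (s : ℕ) (hs : 1 ≤ s) (w : W) (l : Fin g) :
    (p : R) ^ s ∣
      Matrix.vecMul (cartierVec g ((p ^ e) ^ (s + 1)) (f w (s + 1)))
        (Matrix.of fun u => cartierVec g ((p ^ e) ^ (s + 1)) (f (w₀ u) (s + 1)))⁻¹ l -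
      Matrix.vecMul (cartierVec g ((p ^ e) ^ s) (f w s))
        (Matrix.of fun u => cartierVec g ((p ^ e) ^ s) (f (w₀ u) s))⁻¹ l := by
  have hQ : ∀ i, (p ^ e) ^ i ≠ 0 := fun i => pow_ne_zero _ (pow_ne_zero _ hp.ne_zero)
  have h1 := repMod_cartier_mul_pow hp htf he Φ f hf hdeg w₀ hA s hs (Φ 1)
  simp only [← hf _ s 1 hs] at h1
  have h2 := h1.contract (hQ 1)
  simp only [contract_cartier (hQ s) (hQ 1), ← pow_add] at h2
  obtain ⟨B, hB⟩ := h2.exists_matrix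
  exact vecMul_inv_sub_dvd w₀ hB (hA s hs) (hA (s + 1) (by omega)) w l

end Congruence

/-! ### Hasse–Witt matrices and normalized rows -/

section HasseWitt

variable {R : Type*} [CommRing R] {p e q g n : ℕ} {M : ℕ → ℕ}

theorem natDegree_cartier_le {N : ℕ} (hN : N ≠ 0) {f : R[X]}
    (hf : f.natDegree + 1 < (g + 1) * N) : (cartier N f).natDegree ≤ g := by
  rw [natDegree_le_iff_coeff_eq_zero]
  intro m hm
  rw [coeff_cartier hN]
  refine coeff_eq_zero_of_natDegree_lt ?_
  have h1 : (g + 1) * N ≤ m * N := Nat.mul_le_mul_right _ hm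
  have h2 : (X * f).natDegree ≤ 1 + f.natDegree :=
    natDegree_mul_le.trans (Nat.add_le_add_right natDegree_X_le _)
  omega

theorem cartierVec_map {S : Type*} [CommRing S] (φ : R →+* S) {N : ℕ} (hN : N ≠ 0) (f : R[X])
    (l : Fin g) : cartierVec g N (f.map φ) l = φ (cartierVec g N f l) := by
  simp only [cartierVec, coeff_cartier hN]
  rw [← coeff_map]
  simp

theorem exponent_add (hq : 0 < q) (hM : ∀ i, q * M i + 1 = (p ^ e) ^ i) (i k : ℕ) :
    M (i + k) = M i + M k * (p ^ e) ^ i := by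
  refine Nat.eq_of_mul_eq_mul_left hq (Nat.add_right_cancel (m := 1) ?_)
  rw [hM, pow_add, ← hM k]
  nth_rewrite 1 [← hM i]
  rw [← hM i]; ring

theorem exponent_lt (hq : 0 < q) (hM : ∀ i, q * M i + 1 = (p ^ e) ^ i) (i : ℕ) :
    M i < (p ^ e) ^ i := by
  have := hM i
  have := Nat.le_mul_of_pos_left (M i) hq
  omega

/-- This is where the number `g q + 1` of points matters: `g + (g q + 1) M = g (q M + 1) + M`, and
`M < Q^i`. -/
theorem degree_bound (hq : 0 < q) (hM : ∀ i, q * M i + 1 = (p ^ e) ^ i) (i : ℕ) :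
    g + (g * q + 1) * M i < (g + 1) * (p ^ e) ^ i := by
  have h1 := exponent_lt hq hM i
  calc g + (g * q + 1) * M i = g * (q * M i + 1) + M i := by ring
    _ < g * (p ^ e) ^ i + (p ^ e) ^ i := by rw [hM i]; omega
    _ = _ := by ring

/-- The Hasse–Witt matrix of `F ^ M` with respect to the `N`-th power. -/
noncomputable def hwMatrix (g N M : ℕ) (F : R[X]) : Matrix (Fin g) (Fin g) R :=
  Matrix.of fun u => cartierVec g N (X ^ (u : ℕ) * F ^ M)

theorem hwMatrix_map {S : Type*} [CommRing S] (φ : R →+* S) {N : ℕ} (hN : N ≠ 0) (M : ℕ)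
    (F : R[X]) : hwMatrix g N M (F.map φ) = (hwMatrix g N M F).map φ := by
  ext u l
  simp only [hwMatrix, Matrix.of_apply, Matrix.map_apply]
  rw [← cartierVec_map φ hN]
  simp

theorem natDegree_X_pow_mul_pow_le {F : R[X]} (hF : F.natDegree ≤ n) (u M : ℕ) :
    (X ^ u * F ^ M).natDegree ≤ u + n * M := by
  refine natDegree_mul_le.trans (Nat.add_le_add (natDegree_X_pow_le u) ?_)
  rw [mul_comm n]
  exact natDegree_pow_le.trans (Nat.mul_le_mul_left M hF)

/-- In characteristic `p` the extra factor `(F^(M 1))^(Q^s)` is a polynomial in `t^(Q^s)` with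
Frobenius-twisted coefficients, so it passes through the Cartier operator of level `s`. -/
theorem hwMatrix_succ_of_charP [Fact p.Prime] [CharP R p] (hq : 0 < q)
    (hM : ∀ i, q * M i + 1 = (p ^ e) ^ i) {F : R[X]} (hF : F.natDegree ≤ g * q + 1) (s : ℕ) :
    hwMatrix g ((p ^ e) ^ (s + 1)) (M (s + 1)) F =
      hwMatrix g ((p ^ e) ^ s) (M s) F *
        (hwMatrix g (p ^ e) (M 1) F).map (iterateFrobenius R p (e * s)) := by
  have hQ : ∀ i, (p ^ e) ^ i ≠ 0 := fun i =>
    pow_ne_zero _ (pow_ne_zero _ (Fact.out : p.Prime).ne_zero)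
  have hQ1 : p ^ e ≠ 0 := by simpa using hQ 1
  ext u l
  set φ := iterateFrobenius R p (e * s) with hφ
  have h1 : X ^ (u : ℕ) * F ^ M (s + 1) =
      (X ^ (u : ℕ) * F ^ M s) * expand R ((p ^ e) ^ s) ((F ^ M 1).map φ) := by
    rw [exponent_add hq hM, pow_add, mul_assoc, pow_mul, ← map_expand, ← pow_mul p e s, hφ,
      map_iterateFrobenius_expand]
  have hdeg : (cartier ((p ^ e) ^ s) (X ^ (u : ℕ) * F ^ M s)).natDegree ≤ g := by
    refine natDegree_cartier_le (hQ s) ?_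
    have h2 := natDegree_X_pow_mul_pow_le hF (u : ℕ) (M s)
    have h3 := degree_bound (g := g) hq hM s
    have := u.2
    omega
  have h4 : ∀ m : ℕ, contract (p ^ e) (X ^ (m + 1) * (F ^ M 1).map φ) =
      (cartier (p ^ e) (X ^ m * F ^ M 1)).map φ := by
    intro m
    rw [cartier, map_contract hQ1]
    simp [pow_succ', mul_assoc]
  have h5 : cartier ((p ^ e) ^ (s + 1)) (X ^ (u : ℕ) * F ^ M (s + 1)) =
      ∑ m : Fin g, C (cartierVec g ((p ^ e) ^ s) (X ^ (u : ℕ) * F ^ M s) m) *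
        (cartier (p ^ e) (X ^ (m : ℕ) * F ^ M 1)).map φ := by
    rw [h1, pow_succ, ← contract_cartier (hQ s) hQ1, cartier_mul_expand (hQ s),
      cartier_eq_sum (hQ s) hdeg, Finset.sum_mul, contract_sum hQ1]
    refine Finset.sum_congr rfl fun m _ => ?_
    rw [mul_assoc, contract_C_mul hQ1, h4]
  simp only [hwMatrix, Matrix.of_apply, Matrix.mul_apply, Matrix.map_apply]
  conv_lhs => rw [cartierVec, h5]
  simp [finsetSum_coeff, cartierVec]

/-- If the Hasse–Witt matrix is invertible for `s = 1` then it is so for all `s ≥ 1`. -/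
theorem isUnit_det_hwMatrix [Fact p.Prime] (hpR : (p : R) ∈ nonunits R)
    (hloc : ∀ x : R, IsUnit (Ideal.Quotient.mk (Ideal.span {(p : R)}) x) → IsUnit x)
    (hq : 0 < q) (hM : ∀ i, q * M i + 1 = (p ^ e) ^ i) {F : R[X]}
    (hF : F.natDegree ≤ g * q + 1) (h1 : IsUnit (hwMatrix g (p ^ e) (M 1) F).det)
    (s : ℕ) (hs : 1 ≤ s) : IsUnit (hwMatrix g ((p ^ e) ^ s) (M s) F).det := by
  have hQ : ∀ i, (p ^ e) ^ i ≠ 0 := fun i =>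
    pow_ne_zero _ (pow_ne_zero _ (Fact.out : p.Prime).ne_zero)
  have hQ1 : p ^ e ≠ 0 := by simpa using hQ 1
  have := CharP.quotient R p hpR
  induction s, hs using Nat.le_induction with
  | base => simpa using h1
  -- Invertibility is tested modulo `p`, where the Frobenius factorization applies.
  | succ s _ ih =>
    apply hloc
    set π := Ideal.Quotient.mk (Ideal.span {(p : R)})
    rw [RingHom.map_det, RingHom.mapMatrix_apply, ← hwMatrix_map π (hQ _),
      hwMatrix_succ_of_charP hq hM (natDegree_map_le.trans hF), Matrix.det_mul,
      hwMatrix_map π (hQ s), hwMatrix_map π hQ1, ← RingHom.mapMatrix_apply, ← RingHom.map_det]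
    refine (ih.map π).mul ?_
    rw [← RingHom.mapMatrix_apply, ← RingHom.map_det, ← RingHom.mapMatrix_apply,
      ← RingHom.map_det]
    exact (h1.map π).map _

/-- The row of coefficients of `t ^ (l N - 1)` in `E F ^ (M - 2)`, normalized by the Hasse–Witt
matrix of `F ^ M`. -/
noncomputable def normalizedRow (g N M : ℕ) (F E : R[X]) : Fin g → R :=
  Matrix.vecMul (cartierVec g N (E * F ^ (M - 2))) (hwMatrix g N M F)⁻¹

theorem normalizedRow_succ_sub_dvd (hp : p.Prime) (htf : ∀ x : R, (p : R) * x = 0 → x = 0)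
    (he : 0 < e) (hq : 0 < q) (hM : ∀ i, q * M i + 1 = (p ^ e) ^ i) (hM2 : ∀ i, 1 ≤ i → 2 ≤ M i)
    {F : R[X]} (hF : F.natDegree ≤ g * q + 1)
    (hA : ∀ s, 1 ≤ s → IsUnit (hwMatrix g ((p ^ e) ^ s) (M s) F).det)
    {E : R[X]} (hE : E.natDegree + 1 ≤ 2 * (g * q + 1) + g)
    (s : ℕ) (hs : 1 ≤ s) (l : Fin g) :
    (p : R) ^ s ∣ normalizedRow g ((p ^ e) ^ (s + 1)) (M (s + 1)) F E l -
      normalizedRow g ((p ^ e) ^ s) (M s) F E l := by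
  have hQ : ∀ i, (p ^ e) ^ i ≠ 0 := fun i => pow_ne_zero _ (pow_ne_zero _ hp.ne_zero)
  -- All admissible `E` form one family, so a single matrix serves every row. The bound is the one
  -- met by `X^(g-1) F^2`, the last row of the Hasse–Witt matrix.
  let W := {E : R[X] // E.natDegree + 1 ≤ 2 * (g * q + 1) + g}
  let f : W → ℕ → R[X] := fun w i => w.1 * F ^ (M i - 2)
  let w₀ : Fin g → W := fun u => ⟨X ^ (u : ℕ) * F ^ 2, by
    have := natDegree_X_pow_mul_pow_le hF (u : ℕ) 2
    have := u.2
    omega⟩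
  have hf₀ : ∀ i, 1 ≤ i → (Matrix.of fun u => cartierVec g ((p ^ e) ^ i) (f (w₀ u) i)) =
      hwMatrix g ((p ^ e) ^ i) (M i) F := by
    intro i hi
    ext u l
    simp only [f, w₀, hwMatrix, Matrix.of_apply, mul_assoc, ← pow_add,
      Nat.add_sub_cancel' (hM2 i hi)]
  have hf : ∀ w i k, 1 ≤ i → f w (i + k) = f w i * (F ^ M k) ^ ((p ^ e) ^ i) := by
    intro w i k hi
    simp only [f]
    rw [mul_assoc, ← pow_mul, ← pow_add, exponent_add hq hM, Nat.sub_add_comm (hM2 i hi)]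
  have hdeg : ∀ w i, 1 ≤ i → (cartier ((p ^ e) ^ i) (f w i)).natDegree ≤ g := by
    intro w i hi
    refine natDegree_cartier_le (hQ i) ?_
    have h1 : (f w i).natDegree ≤ w.1.natDegree + (M i - 2) * (g * q + 1) :=
      natDegree_mul_le.trans (Nat.add_le_add_left
        (natDegree_pow_le.trans (Nat.mul_le_mul_left _ hF)) _)
    have h2 := w.2
    have h3 := degree_bound (g := g) hq hM i
    have h4 : (M i - 2) * (g * q + 1) + 2 * (g * q + 1) = (g * q + 1) * M i := by
      rw [← add_mul, Nat.sub_add_cancel (hM2 i hi), mul_comm]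
    omega
  have h := vecMul_inv_succ_sub_dvd hp htf he (fun k => F ^ M k) f hf hdeg w₀
    (fun i hi => by rw [hf₀ i hi]; exact hA i hi) s hs ⟨E, hE⟩ l
  rwa [hf₀ s hs, hf₀ (s + 1) (by omega)] at h

end HasseWitt

/-! ### Identities between products of linear factors -/

section LinearFactors

variable {R : Type*} [CommRing R] {n : ℕ}

/-- The polynomial `∏ (t - a_i)`. -/
noncomputable def linProd (a : Fin n → R) : R[X] := ∏ i, (X - C (a i))

/-- The polynomial `∏_{j ≠ k} (t - a_j)`. -/
noncomputable def cofProd (a : Fin n → R) (k : Fin n) : R[X] :=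
  ∏ j ∈ Finset.univ.erase k, (X - C (a j))

theorem X_sub_C_mul_cofProd (a : Fin n → R) (k : Fin n) :
    (X - C (a k)) * cofProd a k = linProd a :=
  Finset.mul_prod_erase Finset.univ (fun j => X - C (a j)) (Finset.mem_univ k)

theorem natDegree_linProd_le (a : Fin n → R) : (linProd a).natDegree ≤ n := by
  refine (natDegree_prod_le _ _).trans
    ((Finset.sum_le_card_nsmul _ _ 1 fun i _ => natDegree_X_sub_C_le _).trans ?_)
  simp

theorem natDegree_cofProd_le (a : Fin n → R) (k : Fin n) : (cofProd a k).natDegree + 1 ≤ n := by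
  have h : (cofProd a k).natDegree ≤ n - 1 := by
    refine (natDegree_prod_le _ _).trans
      ((Finset.sum_le_card_nsmul _ _ 1 fun i _ => natDegree_X_sub_C_le _).trans ?_)
    simp [Finset.card_erase_of_mem]
  have := k.pos
  omega

theorem map_linProd {S : Type*} [CommRing S] (φ : R →+* S) (a : Fin n → R) :
    (linProd a).map φ = linProd fun i => φ (a i) := by
  simp [linProd, Polynomial.map_prod]

theorem map_cofProd {S : Type*} [CommRing S] (φ : R →+* S) (a : Fin n → R) (k : Fin n) :
    (cofProd a k).map φ = cofProd (fun i => φ (a i)) k := by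
  simp [cofProd, Polynomial.map_prod]

theorem linProd_mul_cofProd_sub (a : Fin n → R) (i k : Fin n) :
    linProd a * cofProd a i - linProd a * cofProd a k =
      C (a i - a k) * (cofProd a i * cofProd a k) := by
  have hi := X_sub_C_mul_cofProd a i
  have hk := X_sub_C_mul_cofProd a k
  rw [C_sub]
  linear_combination (-cofProd a i) * hk + cofProd a k * hi

theorem derivative_linProd (a : Fin n → R) : derivative (linProd a) = ∑ j, cofProd a j := by
  simp [linProd, cofProd, derivative_prod_finset]

/-- Division by `t - a_i` is avoided: differentiating `(t - a_i) P_i = F` and multiplying by `P_i`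
gives `F P_i' = P_i ∑_{j ≠ i} P_j`. -/
theorem derivative_cofProd_mul_pow (a : Fin n → R) (i : Fin n) {M : ℕ} (hM : 2 ≤ M) :
    derivative (cofProd a i * linProd a ^ (M - 1)) =
      ((M : R[X]) * ∑ j ∈ Finset.univ.erase i, cofProd a i * cofProd a j +
        ((M : R[X]) - 1) * (cofProd a i * cofProd a i)) * linProd a ^ (M - 2) := by
  obtain ⟨m, rfl⟩ := Nat.exists_eq_add_of_le' hM
  have h1 : cofProd a i + (X - C (a i)) * derivative (cofProd a i) = derivative (linProd a) := by
    rw [← X_sub_C_mul_cofProd a i]; simp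
  have h2 : derivative (linProd a) = cofProd a i + ∑ j ∈ Finset.univ.erase i, cofProd a j := by
    rw [derivative_linProd, Finset.add_sum_erase _ _ (Finset.mem_univ i)]
  have h3 := X_sub_C_mul_cofProd a i
  have h4 : linProd a * derivative (cofProd a i) =
      cofProd a i * ∑ j ∈ Finset.univ.erase i, cofProd a j := by
    linear_combination cofProd a i * h1 + cofProd a i * h2 - derivative (cofProd a i) * h3
  rw [← Finset.mul_sum, derivative_mul, derivative_pow]
  simp only [Nat.add_sub_cancel, show m + 2 - 1 = m + 1 by omega, h2, map_natCast]
  push_cast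
  linear_combination linProd a ^ m * h4

/-- The coefficient of `t^((l+1)N - 1)` in a derivative carries the factor `(l+1)N`. -/
theorem dvd_cartierVec_derivative {g N : ℕ} (hN : N ≠ 0) (f : R[X]) (l : Fin g) :
    (N : R) ∣ cartierVec g N (derivative f) l := by
  have h : ((l : ℕ) + 1) * N - 1 + 1 = ((l : ℕ) + 1) * N :=
    Nat.succ_pred (Nat.mul_ne_zero (Nat.succ_ne_zero _) hN)
  rw [cartierVec, coeff_cartier_succ hN, coeff_derivative, ← Nat.cast_succ, Nat.succ_eq_add_one, h]
  push_cast
  exact Dvd.intro_left (f.coeff (((l : ℕ) + 1) * N) * ((l : R) + 1)) (by ring)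

theorem cartierVec_add {g N : ℕ} (hN : N ≠ 0) (f h : R[X]) :
    cartierVec g N (f + h) = cartierVec g N f + cartierVec g N h := by
  ext l; simp [cartierVec, cartier_add hN]

theorem cartierVec_C_mul {g N : ℕ} (hN : N ≠ 0) (c : R) (f : R[X]) :
    cartierVec g N (C c * f) = c • cartierVec g N f := by
  ext l; simp [cartierVec, cartier_C_mul hN]

theorem normalizedRow_add {g N : ℕ} (hN : N ≠ 0) (M : ℕ) (F E E' : R[X]) :
    normalizedRow g N M F (E + E') = normalizedRow g N M F E + normalizedRow g N M F E' := by
  rw [normalizedRow, add_mul, cartierVec_add hN, Matrix.add_vecMul, normalizedRow, normalizedRow]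

theorem normalizedRow_C_mul {g N : ℕ} (hN : N ≠ 0) (M : ℕ) (F : R[X]) (c : R) (E : R[X]) :
    normalizedRow g N M F (C c * E) = c • normalizedRow g N M F E := by
  rw [normalizedRow, mul_assoc, cartierVec_C_mul hN, Matrix.smul_vecMul, normalizedRow]

theorem normalizedRow_sum {g N : ℕ} (hN : N ≠ 0) (M : ℕ) (F : R[X]) {ι : Type*} (s : Finset ι)
    (E : ι → R[X]) :
    normalizedRow g N M F (∑ i ∈ s, E i) = ∑ i ∈ s, normalizedRow g N M F (E i) := by
  classical
  induction s using Finset.induction_on with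
  | empty => simpa using normalizedRow_C_mul (g := g) hN M F 0 0
  | insert i s hi ih => rw [Finset.sum_insert hi, Finset.sum_insert hi, normalizedRow_add hN, ih]

/-- Vanishing modulo `N` of the class of the total derivative of `∏ (t - a_j) ^ M / (t - a_i)`. -/
theorem dvd_normalizedRow_derivative {g N M : ℕ} (hN : N ≠ 0) (hM : 2 ≤ M) (a : Fin n → R)
    (i : Fin n) (l : Fin g) :
    (N : R) ∣ (M : R) * ∑ j ∈ Finset.univ.erase i,
        normalizedRow g N M (linProd a) (cofProd a i * cofProd a j) l +
      ((M : R) - 1) * normalizedRow g N M (linProd a) (cofProd a i * cofProd a i) l := by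
  have h : (N : R) ∣ normalizedRow g N M (linProd a)
      (C (M : R) * ∑ j ∈ Finset.univ.erase i, cofProd a i * cofProd a j +
        C ((M : R) - 1) * (cofProd a i * cofProd a i)) l := by
    have h1 := derivative_cofProd_mul_pow a i hM
    simp only [normalizedRow, C_sub, C_1, map_natCast, ← h1, Matrix.vecMul, dotProduct]
    exact Finset.dvd_sum fun m _ => (dvd_cartierVec_derivative hN _ m).mul_right _
  rw [normalizedRow_add hN, normalizedRow_C_mul hN, normalizedRow_C_mul hN,
    normalizedRow_sum hN] at h
  simpa using h

end LinearFactors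

/-! ### The matrices of the theorem as Cartier coefficients -/

section Master

variable {R : Type*} [CommRing R] {n g p q s : ℕ}

/-- The exponent `(p ^ (e s) - 1) / q` of the master polynomial. -/
noncomputable def masterExp (p q s : ℕ) : ℕ := (p ^ (expOrder p q * s) - 1) / q

theorem masterPoly_eq : masterPoly n p q s = linProd MvPolynomial.X ^ masterExp p q s := rfl

theorem hasseWitt_map [Fact p.Prime] (hg : g ≤ p ^ (expOrder p q * s)) (a : Fin n → R) :
    (hasseWitt n g p q s).map (MvPolynomial.aeval a) =
      hwMatrix g ((p ^ expOrder p q) ^ s) (masterExp p q s) (linProd a) := by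
  have hN : (p ^ expOrder p q) ^ s ≠ 0 :=
    pow_ne_zero _ (pow_ne_zero _ (Fact.out : p.Prime).ne_zero)
  ext u l
  have hu : (u : ℕ) + 1 ≤ (p ^ expOrder p q) ^ s := by rw [← pow_mul]; have := u.2; omega
  have hle : (p ^ expOrder p q) ^ s ≤ (p ^ expOrder p q) ^ s * ((l : ℕ) + 1) :=
    Nat.le_mul_of_pos_right _ l.1.succ_pos
  simp only [hasseWitt, hwMatrix, cartierVec, Matrix.map_apply, Matrix.of_apply]
  rw [coeff_cartier_succ hN, coeff_X_pow_mul', if_pos (by rw [mul_comm]; omega), masterPoly_eq,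
    pow_mul, ← AlgHom.coe_toRingHom, ← coeff_map, Polynomial.map_pow, map_linProd]
  simp only [AlgHom.coe_toRingHom, MvPolynomial.aeval_X]
  congr 1
  rw [mul_comm]; omega

theorem masterPoly_divByMonic (hs : 1 ≤ masterExp p q s) (k : Fin n) :
    masterPoly n p q s /ₘ (X - C (MvPolynomial.X k)) =
      cofProd MvPolynomial.X k * linProd MvPolynomial.X ^ (masterExp p q s - 1) := by
  conv_lhs => rw [masterPoly_eq, ← Nat.sub_add_cancel hs, pow_succ',
    ← X_sub_C_mul_cofProd MvPolynomial.X k, mul_assoc]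
  rw [mul_divByMonic_cancel_left _ (monic_X_sub_C _), X_sub_C_mul_cofProd]

theorem hypergeomSol_map [Fact p.Prime] (hs : 2 ≤ masterExp p q s) (a : Fin n → R) (k : Fin n) :
    (hypergeomSol n g p q s).map (MvPolynomial.aeval a) k =
      cartierVec g ((p ^ expOrder p q) ^ s)
        (linProd a * cofProd a k * linProd a ^ (masterExp p q s - 2)) := by
  have hN : (p ^ expOrder p q) ^ s ≠ 0 :=
    pow_ne_zero _ (pow_ne_zero _ (Fact.out : p.Prime).ne_zero)
  ext l
  have h : linProd a * cofProd a k * linProd a ^ (masterExp p q s - 2) =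
      cofProd a k * linProd a ^ (masterExp p q s - 1) := by
    rw [show masterExp p q s - 1 = masterExp p q s - 2 + 1 by omega]; ring
  simp only [hypergeomSol, cartierVec, Matrix.map_apply, Matrix.of_apply]
  rw [coeff_cartier_succ hN, h, masterPoly_divByMonic (by omega), pow_mul,
    ← AlgHom.coe_toRingHom, ← coeff_map, Polynomial.map_mul, Polynomial.map_pow, map_linProd,
    map_cofProd]
  simp only [AlgHom.coe_toRingHom, MvPolynomial.aeval_X]

/-- The coefficientwise extension of `∂/∂z_i` to polynomials in `t`. -/
noncomputable def coeffPDeriv (i : Fin n) :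
    Derivation ℤ (MvPolynomial (Fin n) ℤ)[X] (MvPolynomial (Fin n) ℤ)[X] :=
  PolynomialModule.equivPolynomialSelf.toLinearMap.compDer (MvPolynomial.pderiv i).mapCoeffs

theorem coeff_coeffPDeriv (i : Fin n) (f : (MvPolynomial (Fin n) ℤ)[X]) (m : ℕ) :
    (coeffPDeriv i f).coeff m = MvPolynomial.pderiv i (f.coeff m) := by
  rfl

theorem coeffPDeriv_X_sub_C (i k : Fin n) :
    coeffPDeriv i (X - C (MvPolynomial.X k)) = if k = i then -1 else 0 := by
  classical
  ext m : 1
  rw [coeff_coeffPDeriv, coeff_sub, map_sub, coeff_X, coeff_C]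
  rcases eq_or_ne k i with rfl | h
  · by_cases hm : m = 0 <;> simp [hm, apply_ite, coeff_one]
  · by_cases hm : m = 0 <;> simp [hm, h, apply_ite, MvPolynomial.pderiv_X_of_ne h]

theorem coeffPDeriv_cofProd_self (i : Fin n) :
    coeffPDeriv i (cofProd MvPolynomial.X i) = 0 := by
  classical
  have h : ∀ s : Finset (Fin n), i ∉ s →
      coeffPDeriv i (∏ j ∈ s, (X - C (MvPolynomial.X j))) = 0 := by
    intro s
    induction s using Finset.induction_on with
    | empty => intro _; simp
    | insert a s ha ih =>
      intro hi
      rw [Finset.mem_insert, not_or] at hi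
      rw [Finset.prod_insert ha, Derivation.leibniz, ih hi.2, coeffPDeriv_X_sub_C,
        if_neg (Ne.symm hi.1)]
      simp
  exact h _ (Finset.notMem_erase _ _)

theorem coeffPDeriv_linProd (i : Fin n) :
    coeffPDeriv i (linProd MvPolynomial.X) = -cofProd MvPolynomial.X i := by
  rw [← X_sub_C_mul_cofProd _ i, Derivation.leibniz, coeffPDeriv_cofProd_self,
    coeffPDeriv_X_sub_C, if_pos rfl, smul_zero, zero_add]
  ring

/-- Differentiating the power of `F` contributes `-(M - 1)`. If `k ≠ i`, then `F ∂_i P_k = -P_i P_k`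
contributes a further `-1`; if `k = i`, the cofactor does not involve `z_i`. -/
theorem coeffPDeriv_cofProd_mul_pow (i k : Fin n) {M : ℕ} (hM : 2 ≤ M) :
    coeffPDeriv i (cofProd MvPolynomial.X k * linProd MvPolynomial.X ^ (M - 1)) =
      (C ((if k = i then 1 else 0) - (M : MvPolynomial (Fin n) ℤ)) *
        (cofProd MvPolynomial.X i * cofProd MvPolynomial.X k)) *
          linProd MvPolynomial.X ^ (M - 2) := by
  obtain ⟨m, rfl⟩ := Nat.exists_eq_add_of_le' hM
  have h1 := X_sub_C_mul_cofProd (R := MvPolynomial (Fin n) ℤ) MvPolynomial.X k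
  have h2 := congrArg (coeffPDeriv i) h1
  rw [Derivation.leibniz, coeffPDeriv_linProd, coeffPDeriv_X_sub_C] at h2
  rw [Derivation.leibniz, Derivation.leibniz_pow, coeffPDeriv_linProd]
  simp only [Nat.add_sub_cancel, show m + 2 - 1 = m + 1 by omega, smul_eq_mul, nsmul_eq_mul,
    C_sub, map_natCast] at h2 ⊢
  push_cast
  set P := cofProd (R := MvPolynomial (Fin n) ℤ) MvPolynomial.X k
  set F := linProd (R := MvPolynomial (Fin n) ℤ) MvPolynomial.X
  rcases eq_or_ne k i with rfl | h
  · have h3 : coeffPDeriv k P = 0 := coeffPDeriv_cofProd_self k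
    simp only [if_true, h3, C_1]
    ring
  · simp only [if_neg h, C_0] at h2 ⊢
    linear_combination F ^ m * (P * h2 - coeffPDeriv i P * h1)

theorem pderiv_hypergeomSol_map [Fact p.Prime] (hs : 2 ≤ masterExp p q s) (a : Fin n → R)
    (i k : Fin n) :
    (pderivMatrix i (hypergeomSol n g p q s)).map (MvPolynomial.aeval a) k =
      cartierVec g ((p ^ expOrder p q) ^ s)
        (C ((if k = i then 1 else 0) - (masterExp p q s : R)) * (cofProd a i * cofProd a k) *
          linProd a ^ (masterExp p q s - 2)) := by
  have hN : (p ^ expOrder p q) ^ s ≠ 0 :=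
    pow_ne_zero _ (pow_ne_zero _ (Fact.out : p.Prime).ne_zero)
  ext l
  simp only [pderivMatrix, hypergeomSol, cartierVec, Matrix.map_apply, Matrix.of_apply]
  rw [coeff_cartier_succ hN, masterPoly_divByMonic (by omega), pow_mul, ← coeff_coeffPDeriv,
    coeffPDeriv_cofProd_mul_pow i k hs, ← AlgHom.coe_toRingHom, ← coeff_map, Polynomial.map_mul,
    Polynomial.map_mul, Polynomial.map_mul, Polynomial.map_pow, map_linProd, map_cofProd,
    map_cofProd, Polynomial.map_C]
  simp only [AlgHom.coe_toRingHom, MvPolynomial.aeval_X, map_sub, map_natCast, apply_ite, map_one,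
    map_zero]

end Master

/-! ### The valuation ring -/

section UnitBall

/-- The closed unit ball of a nonarchimedean normed field. -/
def unitBall (K : Type*) [NormedField K] [IsUltrametricDist K] : Subring K where
  carrier := {x | ‖x‖ ≤ 1}
  mul_mem' {x y} hx hy := by
    simpa using mul_le_one₀ (Set.mem_ofPred.1 hx) (norm_nonneg y) (Set.mem_ofPred.1 hy)
  one_mem' := by simp
  add_mem' {x y} hx hy := (IsUltrametricDist.norm_add_le_max x y).trans (max_le hx hy)
  zero_mem' := by simp
  neg_mem' {x} hx := by simpa using hx

variable {K : Type*} [NormedField K] [IsUltrametricDist K]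

theorem unitBall.norm_le_one (x : unitBall K) : ‖(x : K)‖ ≤ 1 := x.2

theorem unitBall.isUnit_iff {x : unitBall K} : IsUnit x ↔ ‖(x : K)‖ = 1 := by
  constructor
  · rintro ⟨u, rfl⟩
    refine le_antisymm (norm_le_one _) ?_
    have h : ((u : unitBall K) : K) * ((u⁻¹ : (unitBall K)ˣ) : unitBall K) = 1 := by
      rw [← Subring.coe_mul, Units.mul_inv, Subring.coe_one]
    calc (1 : ℝ) = ‖((u : unitBall K) : K)‖ * ‖(((u⁻¹ : (unitBall K)ˣ) : unitBall K) : K)‖ := by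
          rw [← norm_mul, h, norm_one]
      _ ≤ ‖((u : unitBall K) : K)‖ := mul_le_of_le_one_right (norm_nonneg _) (norm_le_one _)
  · intro h
    have h0 : (x : K) ≠ 0 := by rw [← norm_ne_zero_iff, h]; exact one_ne_zero
    refine IsUnit.of_mul_eq_one ⟨(x : K)⁻¹, ?_⟩ (Subtype.ext ?_)
    · change ‖(x : K)⁻¹‖ ≤ 1
      rw [norm_inv, h, inv_one]
    · simp [h0]

variable {p : ℕ}

theorem unitBall.norm_le_of_dvd {x : unitBall K} {s : ℕ} (h : (p : unitBall K) ^ s ∣ x) :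
    ‖(x : K)‖ ≤ ‖(p : K)‖ ^ s := by
  obtain ⟨y, rfl⟩ := h
  simpa using mul_le_of_le_one_right (pow_nonneg (norm_nonneg (p : K)) s) (norm_le_one y)

theorem unitBall.natCast_mem_nonunits (hp : ‖(p : K)‖ < 1) :
    (p : unitBall K) ∈ nonunits (unitBall K) := by
  rw [mem_nonunits_iff, isUnit_iff]
  simpa using hp.ne

/-- If `x y ≡ 1` modulo `p`, then `|x y - 1| < 1`, and the ultrametric inequality forces `|x y| =
1`. -/
theorem unitBall.isUnit_of_isUnit_quotient (hp : ‖(p : K)‖ < 1) (x : unitBall K)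
    (h : IsUnit (Ideal.Quotient.mk (Ideal.span {(p : unitBall K)}) x)) : IsUnit x := by
  obtain ⟨y', hy⟩ := h.exists_right_inv
  obtain ⟨y, rfl⟩ := Ideal.Quotient.mk_surjective y'
  rw [← map_mul, ← map_one (Ideal.Quotient.mk _), ← dvd_sub_iff_quotient] at hy
  rw [← pow_one (p : unitBall K)] at hy
  have h1 : ‖((x * y - 1 : unitBall K) : K)‖ < 1 := by
    simpa using (norm_le_of_dvd hy).trans_lt (by simpa using hp)
  have h2 : IsUnit (x * y) := by
    rw [isUnit_iff]
    have h3 := IsUltrametricDist.norm_add_eq_max_of_norm_ne_norm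
      (x := ((x * y - 1 : unitBall K) : K)) (y := 1) (by rw [norm_one]; exact h1.ne)
    rw [norm_one, max_eq_right h1.le] at h3
    simpa using h3
  exact isUnit_of_mul_isUnit_left h2

theorem evalMatrix_coe {n : ℕ} {ι κ : Type*} (a : Fin n → unitBall K)
    (M : Matrix ι κ (MvPolynomial (Fin n) ℤ)) :
    evalMatrix (fun i => (a i : K)) M =
      (M.map (MvPolynomial.aeval a)).map (unitBall K).subtype := by
  ext i j
  have h := MvPolynomial.comp_aeval_apply a ((unitBall K).subtype.toIntAlgHom) (M i j)
  simp only [evalMatrix, Matrix.map_apply]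
  exact h.symm

theorem map_mul_map_inv_apply {n g : ℕ} {R L : Type*} [CommRing R] [Field L] (φ : R →+* L)
    (V : Matrix (Fin n) (Fin g) R) {A : Matrix (Fin g) (Fin g) R} (hA : IsUnit A.det) (k : Fin n)
    (l : Fin g) : (V.map φ * (A.map φ)⁻¹) k l = φ (Matrix.vecMul (V k) A⁻¹ l) := by
  have h : (A.map φ)⁻¹ = A⁻¹.map φ := by
    apply Matrix.inv_eq_right_inv
    rw [← Matrix.map_mul, Matrix.mul_nonsing_inv _ hA, Matrix.map_one _ (map_zero φ) (map_one φ)]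
  rw [h, ← Matrix.map_mul]
  rfl

end UnitBall

/-! ### Uniform limits from geometric bounds -/

section Limits

variable {K α : Type*} [NormedField K]

theorem cauchySeq_of_norm_succ_sub_le {r : ℝ} (hr : r < 1) {y : ℕ → K}
    (hy : ∀ s, 1 ≤ s → ‖y (s + 1) - y s‖ ≤ r ^ s) : CauchySeq fun s => y (s + 1) :=
  cauchySeq_of_le_geometric r r hr fun s => by
    rw [dist_comm, dist_eq_norm, ← pow_succ']
    exact hy (s + 1) (by omega)

theorem exists_tendsto_of_norm_succ_sub_le [CompleteSpace K] {r : ℝ} (hr : r < 1) {y : ℕ → K}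
    (hy : ∀ s, 1 ≤ s → ‖y (s + 1) - y s‖ ≤ r ^ s) : ∃ L, Tendsto y atTop (nhds L) := by
  obtain ⟨L, hL⟩ := cauchySeq_tendsto_of_complete (cauchySeq_of_norm_succ_sub_le hr hy)
  exact ⟨L, (tendsto_add_atTop_iff_nat 1).1 hL⟩

theorem exists_tendstoUniformlyOn [CompleteSpace K] {r : ℝ} (hr0 : 0 ≤ r) (hr : r < 1)
    {y : ℕ → α → K} {D : Set α}
    (hy : ∀ a ∈ D, ∀ s, 1 ≤ s → ‖y (s + 1) a - y s a‖ ≤ r ^ s) :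
    ∃ L : α → K, TendstoUniformlyOn y L atTop D := by
  classical
  have h : ∀ a, ∃ L, a ∈ D → Tendsto (fun s => y s a) atTop (nhds L) := fun a => by
    by_cases ha : a ∈ D
    · obtain ⟨L, hL⟩ := exists_tendsto_of_norm_succ_sub_le (y := fun s => y s a) hr (hy a ha)
      exact ⟨L, fun _ => hL⟩
    -- Outside `D` the limit function gets the default value zero.
    · exact ⟨0, fun h => absurd h ha⟩
  choose L hL using h
  refine ⟨L, ?_⟩
  rw [Metric.tendstoUniformlyOn_iff]
  intro ε hε
  have h0 : Tendsto (fun s : ℕ => r * r ^ s / (1 - r)) atTop (nhds 0) := by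
    simpa using ((tendsto_pow_atTop_nhds_zero_of_lt_one hr0 hr).const_mul r).div_const (1 - r)
  rw [eventually_atTop]
  obtain ⟨N, hN⟩ := eventually_atTop.1 (h0.eventually_lt_const hε)
  refine ⟨N + 1, fun s hs a ha => ?_⟩
  obtain ⟨t, rfl⟩ := Nat.exists_eq_add_of_le' (show 1 ≤ s by omega)
  rw [dist_comm]
  refine (dist_le_of_le_geometric_of_tendsto r r hr (f := fun s => y (s + 1) a) (fun s => ?_)
    ((tendsto_add_atTop_iff_nat 1).2 (hL a ha)) t).trans_lt (hN t (by omega))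
  rw [dist_comm, dist_eq_norm, ← pow_succ']
  exact hy a ha (s + 1) (by omega)

theorem exists_tendstoUniformlyOn_matrix [CompleteSpace K] {n g : ℕ} {r : ℝ} (hr0 : 0 ≤ r)
    (hr : r < 1) {y : ℕ → α → Matrix (Fin n) (Fin g) K} {D : Set α}
    (hy : ∀ a ∈ D, ∀ s, 1 ≤ s → ∀ k l, ‖y (s + 1) a k l - y s a k l‖ ≤ r ^ s) :
    ∃ L : α → Matrix (Fin n) (Fin g) K, TendstoUniformlyOn y L atTop D := by
  have h : ∀ k l, ∃ L : α → K, TendstoUniformlyOn (fun s a => y s a k l) L atTop D :=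
    fun k l => exists_tendstoUniformlyOn hr0 hr fun a ha s hs => hy a ha s hs k l
  choose L hL using h
  refine ⟨fun a => Matrix.of fun k l => L k l a, ?_⟩
  rw [tendstoUniformlyOn_iff_tendsto]
  simp only [Matrix.uniformity, tendsto_iInf, tendsto_comap_iff]
  intro k l
  exact tendstoUniformlyOn_iff_tendsto.1 (hL k l)

end Limits

/-! ### Arithmetic of the exponents -/

section Exponents

variable {p q g : ℕ} [Fact p.Prime]

theorem dvd_pow_expOrder_sub_one (s : ℕ) : q ∣ p ^ (expOrder p q * s) - 1 := by
  have h1 : 1 ≤ p ^ (expOrder p q * s) := Nat.one_le_pow _ _ (Fact.out : p.Prime).pos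
  rw [← ZMod.natCast_eq_zero_iff, Nat.cast_sub h1, Nat.cast_pow, pow_mul, expOrder,
    pow_orderOf_eq_one]
  simp

theorem mul_masterExp_add_one (s : ℕ) : q * masterExp p q s + 1 = (p ^ expOrder p q) ^ s := by
  have h1 : 1 ≤ p ^ (expOrder p q * s) := Nat.one_le_pow _ _ (Fact.out : p.Prime).pos
  rw [masterExp, Nat.mul_div_cancel' (dvd_pow_expOrder_sub_one s), ← pow_mul]
  omega

theorem expOrder_pos {p q g : ℕ} (hpe : g * q + 1 < p ^ expOrder p q) :
    0 < expOrder p q := by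
  by_contra h
  have h0 : expOrder p q = 0 := by omega
  rw [h0, pow_zero] at hpe
  omega

theorem pow_expOrder_le_pow {p q s : ℕ} (hs : 1 ≤ s) :
    p ^ expOrder p q ≤ (p ^ expOrder p q) ^ s :=
  Nat.le_self_pow (by omega) _

/-- From `q M + 1 ≥ p^e > g q + 1` follows `M > g ≥ 1`. -/
theorem two_le_masterExp (hg : 0 < g) (hpe : g * q + 1 < p ^ expOrder p q) {s : ℕ} (hs : 1 ≤ s) :
    2 ≤ masterExp p q s := by
  have h1 := mul_masterExp_add_one (p := p) (q := q) s
  have h2 := pow_expOrder_le_pow (p := p) (q := q) hs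
  have h3 : q * g < q * masterExp p q s := by rw [mul_comm q g]; omega
  have := Nat.lt_of_mul_lt_mul_left h3
  omega

theorem le_pow_expOrder {p q g s : ℕ} (hq : 0 < q) (hpe : g * q + 1 < p ^ expOrder p q) (hs : 1 ≤ s) :
    g ≤ p ^ (expOrder p q * s) := by
  have h2 := pow_expOrder_le_pow (p := p) (q := q) hs
  rw [pow_mul]
  have := Nat.le_mul_of_pos_right g hq
  omega

end Exponents

/-! ### From relations between limits to the KZ equations -/

section GaudinHamiltonian

variable {K : Type*} [Field K] {q g : ℕ}

theorem Omega_mul_apply {n : ℕ} (i j : Fin n) (I : Matrix (Fin n) (Fin g) K) (k : Fin n)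
    (l : Fin g) : (Omega K i j * I) k l =
      (if k = i then I j l - I i l else 0) + (if k = j then I i l - I j l else 0) := by
  have h : ∀ i j : Fin n, (Matrix.single i j (1 : K) * I) k l = if k = i then I j l else 0 := by
    intro i j
    rcases eq_or_ne k i with rfl | h
    · simp
    · simp [h]
  simp only [Omega, Matrix.sub_mul, Matrix.add_mul, Matrix.sub_apply, Matrix.add_apply, h]
  split_ifs <;> ring

theorem Omega_mul_apply_of_relations {n : ℕ} {I : Matrix (Fin n) (Fin g) K} {a : Fin n → K}
    {i j : Fin n} {l : Fin g} {J : Fin n → K}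
    (hI : I i l - I j l = (a i - a j) * J j) (k : Fin n) :
    (Omega K i j * I) k l =
      (a i - a j) * ((if k = j then J j else 0) - (if k = i then J j else 0)) := by
  rw [Omega_mul_apply, ← neg_sub (I i l) (I j l), hI]
  split_ifs <;> ring

theorem sum_of_relations {n : ℕ} {I' : Matrix (Fin n) (Fin g) K}
    {i : Fin n} {l : Fin g} {J : Fin n → K}
    (h1 : ∀ k, k ≠ i → I' k l = (q : K)⁻¹ * J k)
    (h2 : I' i l = -(q : K)⁻¹ * ∑ j ∈ Finset.univ.erase i, J j) (k : Fin n) :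
    I' k l = (q : K)⁻¹ * ∑ j ∈ Finset.univ.erase i,
      ((if k = j then J j else 0) - (if k = i then J j else 0)) := by
  rw [Finset.sum_sub_distrib, Finset.sum_ite_eq]
  rcases eq_or_ne k i with rfl | h
  · simp [h2]; ring
  · simp [h, h1 k h]

/-- The Knizhnik–Zamolodchikov equations for the limits, from the relations between them. -/
theorem kz_of_relations {n : ℕ} {I I' : Matrix (Fin n) (Fin g) K} {a : Fin n → K} {i : Fin n}
    (h : ∀ l, ∃ J : Fin n → K, (∀ k, I i l - I k l = (a i - a k) * J k) ∧
      (∀ k, k ≠ i → I' k l = (q : K)⁻¹ * J k) ∧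
      I' i l = -(q : K)⁻¹ * ∑ j ∈ Finset.univ.erase i, J j) :
    ((∀ j, j ≠ i → a i ≠ a j) → I' = gaudinH q i a * I) ∧
      (∏ j ∈ Finset.univ.erase i, (a i - a j)) • I' =
        (q : K)⁻¹ • ∑ j ∈ Finset.univ.erase i,
          (∏ k ∈ (Finset.univ.erase i).erase j, (a i - a k)) • (Omega K i j * I) := by
  constructor
  · intro hne
    ext k l
    obtain ⟨J, h0, h1, h2⟩ := h l
    rw [sum_of_relations h1 h2, gaudinH, Matrix.smul_mul, Matrix.smul_apply, Matrix.sum_mul,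
      Matrix.sum_apply, smul_eq_mul]
    congr 1
    refine Finset.sum_congr rfl fun j hj => ?_
    have hj' : a i - a j ≠ 0 := sub_ne_zero.2 (hne j (Finset.ne_of_mem_erase hj))
    rw [Matrix.smul_mul, Matrix.smul_apply, Omega_mul_apply_of_relations (h0 j), smul_eq_mul,
      inv_mul_cancel_left₀ hj']
  · ext k l
    obtain ⟨J, h0, h1, h2⟩ := h l
    rw [Matrix.smul_apply, sum_of_relations h1 h2, Matrix.smul_apply, Matrix.sum_apply,
      smul_eq_mul, smul_eq_mul, mul_left_comm, Finset.mul_sum]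
    congr 1
    refine Finset.sum_congr rfl fun j hj => ?_
    rw [Matrix.smul_apply, Omega_mul_apply_of_relations (h0 j), smul_eq_mul, ← mul_assoc,
      Finset.prod_erase_mul _ (fun k => a i - a k) hj]

end GaudinHamiltonian

/-! ### Convergence and limit relations at a point -/

section Solutions

variable {K : Type*} [NormedField K] [IsUltrametricDist K] {p q g s : ℕ} [Fact p.Prime]

/-- The row of coefficients attached to `E`, normalized by the Hasse–Witt matrix at level `s`. -/
noncomputable def levelRow (p q g s : ℕ) {R : Type*} [CommRing R] (F E : R[X]) : Fin g → R :=
  normalizedRow g ((p ^ expOrder p q) ^ s) (masterExp p q s) F E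

/-- The Hasse–Witt matrices at a point of the domain are invertible over the unit ball. -/
theorem exists_lift_of_mem_domain (hp1 : ‖(p : K)‖ < 1) (hq : 0 < q)
    (hpe : g * q + 1 < p ^ expOrder p q)
    {a : Fin (g * q + 1) → K} (ha : ∀ i, ‖a i‖ ≤ 1)
    (hdet : ‖(evalMatrix a (hasseWitt (g * q + 1) g p q 1)).det‖ = 1) :
    ∃ b : Fin (g * q + 1) → unitBall K, (a = fun i => (b i : K)) ∧ ∀ s, 1 ≤ s →
      IsUnit (hwMatrix g ((p ^ expOrder p q) ^ s) (masterExp p q s) (linProd b)).det := by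
  refine ⟨fun i => ⟨a i, ha i⟩, rfl, ?_⟩
  set b : Fin (g * q + 1) → unitBall K := fun i => ⟨a i, ha i⟩
  refine isUnit_det_hwMatrix (unitBall.natCast_mem_nonunits hp1)
    (unitBall.isUnit_of_isUnit_quotient hp1) hq mul_masterExp_add_one (natDegree_linProd_le b) ?_
  have h : evalMatrix a (hasseWitt (g * q + 1) g p q 1) =
      (hwMatrix g (p ^ expOrder p q) (masterExp p q 1) (linProd b)).map (unitBall K).subtype := by
    rw [show a = fun i => (b i : K) from rfl, evalMatrix_coe,
      hasseWitt_map (le_pow_expOrder hq hpe le_rfl), pow_one]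
  rw [unitBall.isUnit_iff, ← hdet, h, ← RingHom.mapMatrix_apply, ← RingHom.map_det]
  rfl

theorem solution_apply (hq : 0 < q) (hg : 0 < g) (hpe : g * q + 1 < p ^ expOrder p q) (hs : 1 ≤ s)
    (b : Fin (g * q + 1) → unitBall K)
    (hA : IsUnit (hwMatrix g ((p ^ expOrder p q) ^ s) (masterExp p q s) (linProd b)).det)
    (k : Fin (g * q + 1)) (l : Fin g) :
    (evalMatrix (fun i => (b i : K)) (hypergeomSol (g * q + 1) g p q s) *
      (evalMatrix (fun i => (b i : K)) (hasseWitt (g * q + 1) g p q s))⁻¹) k l =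
      levelRow p q g s (linProd b) (linProd b * cofProd b k) l := by
  rw [evalMatrix_coe, evalMatrix_coe, hasseWitt_map (le_pow_expOrder hq hpe hs),
    map_mul_map_inv_apply _ _ hA, hypergeomSol_map (two_le_masterExp hg hpe hs)]
  rfl

theorem pderiv_solution_apply (hq : 0 < q) (hg : 0 < g) (hpe : g * q + 1 < p ^ expOrder p q)
    (hs : 1 ≤ s) (b : Fin (g * q + 1) → unitBall K)
    (hA : IsUnit (hwMatrix g ((p ^ expOrder p q) ^ s) (masterExp p q s) (linProd b)).det)
    (i k : Fin (g * q + 1)) (l : Fin g) :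
    (evalMatrix (fun i => (b i : K)) (pderivMatrix i (hypergeomSol (g * q + 1) g p q s)) *
      (evalMatrix (fun i => (b i : K)) (hasseWitt (g * q + 1) g p q s))⁻¹) k l =
      (((if k = i then 1 else 0) - (masterExp p q s : unitBall K)) *
        levelRow p q g s (linProd b) (cofProd b i * cofProd b k) l : unitBall K) := by
  have hN : (p ^ expOrder p q) ^ s ≠ 0 :=
    pow_ne_zero _ (pow_ne_zero _ (Fact.out : p.Prime).ne_zero)
  rw [evalMatrix_coe, evalMatrix_coe, hasseWitt_map (le_pow_expOrder hq hpe hs),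
    map_mul_map_inv_apply _ _ hA, pderiv_hypergeomSol_map (two_le_masterExp hg hpe hs)]
  have h := congrFun (normalizedRow_C_mul (g := g) hN (masterExp p q s) (linProd b)
    ((if k = i then 1 else 0) - (masterExp p q s : unitBall K)) (cofProd b i * cofProd b k)) l
  rw [Pi.smul_apply, smul_eq_mul] at h
  rw [levelRow, ← h]
  rfl

variable [CharZero K]

theorem levelRow_succ_sub_dvd (hq : 0 < q) (hg : 0 < g)
    (hpe : g * q + 1 < p ^ expOrder p q) (b : Fin (g * q + 1) → unitBall K)
    (hA : ∀ s, 1 ≤ s →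
      IsUnit (hwMatrix g ((p ^ expOrder p q) ^ s) (masterExp p q s) (linProd b)).det)
    {E : (unitBall K)[X]} (hE : E.natDegree + 1 ≤ 2 * (g * q + 1) + g) (hs : 1 ≤ s) (l : Fin g) :
    (p : unitBall K) ^ s ∣
      levelRow p q g (s + 1) (linProd b) E l - levelRow p q g s (linProd b) E l := by
  refine normalizedRow_succ_sub_dvd Fact.out (fun x hx => ?_) (expOrder_pos hpe) hq
    mul_masterExp_add_one (fun i => two_le_masterExp hg hpe) (natDegree_linProd_le b) hA hE s hs l
  have hp0 : ((p : unitBall K) : K) ≠ 0 := by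
    simpa using (Fact.out : p.Prime).ne_zero
  refine Subtype.ext ((mul_eq_zero.1 ?_).resolve_left hp0)
  exact congrArg Subtype.val hx

theorem pow_dvd_pow_expOrder {p q : ℕ} {R : Type*} [CommRing R] (he : 0 < expOrder p q) (s : ℕ) :
    (p : R) ^ s ∣ (((p ^ expOrder p q) ^ s : ℕ) : R) := by
  rw [← pow_mul, Nat.cast_pow]
  exact pow_dvd_pow _ (Nat.le_mul_of_pos_left s he)

/-- The scalar also converges at the required rate, because `M_(s+1) - M_s = M_1 Q^s` is divisible
by `p^s`. -/
theorem masterExp_mul_levelRow_succ_sub_dvd (hq : 0 < q) (hg : 0 < g)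
    (hpe : g * q + 1 < p ^ expOrder p q) (b : Fin (g * q + 1) → unitBall K)
    (hA : ∀ s, 1 ≤ s →
      IsUnit (hwMatrix g ((p ^ expOrder p q) ^ s) (masterExp p q s) (linProd b)).det)
    {E : (unitBall K)[X]} (hE : E.natDegree + 1 ≤ 2 * (g * q + 1) + g) (hs : 1 ≤ s) (l : Fin g)
    (c : unitBall K) :
    (p : unitBall K) ^ s ∣
      (c - (masterExp p q (s + 1) : unitBall K)) * levelRow p q g (s + 1) (linProd b) E l -
        (c - (masterExp p q s : unitBall K)) * levelRow p q g s (linProd b) E l := by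
  have h1 := levelRow_succ_sub_dvd hq hg hpe b hA hE hs l
  have h2 := pow_dvd_pow_expOrder (R := unitBall K) (expOrder_pos hpe) s
  rw [exponent_add hq mul_masterExp_add_one s 1, Nat.cast_add, Nat.cast_mul]
  convert (h1.mul_left (c - (masterExp p q s + masterExp p q 1 *
    ((p ^ expOrder p q) ^ s : ℕ) : unitBall K))).sub
    ((h2.mul_left (masterExp p q 1 : unitBall K)).mul_right
      (levelRow p q g s (linProd b) E l)) using 1
  ring

theorem natDegree_linProd_mul_cofProd {R : Type*} [CommRing R] (b : Fin (g * q + 1) → R)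
    (k : Fin (g * q + 1)) :
    (linProd b * cofProd b k).natDegree + 1 ≤ 2 * (g * q + 1) + g := by
  have h1 := natDegree_mul_le (p := linProd b) (q := cofProd b k)
  have h2 := natDegree_linProd_le b
  have h3 := natDegree_cofProd_le b k
  omega

theorem natDegree_cofProd_mul_cofProd {R : Type*} [CommRing R] (b : Fin (g * q + 1) → R)
    (i k : Fin (g * q + 1)) :
    (cofProd b i * cofProd b k).natDegree + 1 ≤ 2 * (g * q + 1) + g := by
  have h1 := natDegree_mul_le (p := cofProd b i) (q := cofProd b k)
  have h2 := natDegree_cofProd_le b i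
  have h3 := natDegree_cofProd_le b k
  omega

theorem tendsto_masterExp (hp1 : ‖(p : K)‖ < 1) (hq : 0 < q) (he : 0 < expOrder p q) :
    Tendsto (fun s => (masterExp p q s : K)) atTop (nhds (-(q : K)⁻¹)) := by
  have hq0 : (q : K) ≠ 0 := Nat.cast_ne_zero.2 hq.ne'
  have h : ∀ s, (masterExp p q s : K) = (q : K)⁻¹ * (((p : K) ^ expOrder p q) ^ s - 1) := by
    intro s
    have := congrArg (Nat.cast (R := K)) (mul_masterExp_add_one (p := p) (q := q) s)
    push_cast at this
    rw [← this]
    field_simp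
    ring
  simp only [h]
  have h1 : Tendsto (fun s : ℕ => ((p : K) ^ expOrder p q) ^ s) atTop (nhds 0) := by
    refine tendsto_pow_atTop_nhds_zero_of_norm_lt_one ?_
    rw [norm_pow]
    exact pow_lt_one₀ (norm_nonneg _) hp1 he.ne'
  simpa using (h1.sub_const 1).const_mul (q : K)⁻¹

/-- The limits at a point, described by the limits `J` attached to the functions
`1 / ((t - a_i) (t - a_k))`. -/
theorem exists_limit_relations [CompleteSpace K] (hp1 : ‖(p : K)‖ < 1) (hq : 0 < q) (hg : 0 < g)
    (hpe : g * q + 1 < p ^ expOrder p q) (b : Fin (g * q + 1) → unitBall K)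
    (hA : ∀ s, 1 ≤ s →
      IsUnit (hwMatrix g ((p ^ expOrder p q) ^ s) (masterExp p q s) (linProd b)).det)
    {I : Matrix (Fin (g * q + 1)) (Fin g) K}
    {I' : Fin (g * q + 1) → Matrix (Fin (g * q + 1)) (Fin g) K}
    (hI : ∀ k l, Tendsto (fun s => ((levelRow p q g s (linProd b) (linProd b * cofProd b k) l : unitBall K) : K))
      atTop (nhds (I k l)))
    (hI' : ∀ i k l, Tendsto (fun s => ((((if k = i then 1 else 0) - (masterExp p q s : unitBall K)) *
        levelRow p q g s (linProd b) (cofProd b i * cofProd b k) l : unitBall K) : K))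
      atTop (nhds (I' i k l))) (i : Fin (g * q + 1)) (l : Fin g) :
    ∃ J : Fin (g * q + 1) → K,
      (∀ k, I i l - I k l = ((b i : K) - b k) * J k) ∧
      (∀ k, k ≠ i → I' i k l = (q : K)⁻¹ * J k) ∧
      I' i i l = -(q : K)⁻¹ * ∑ j ∈ Finset.univ.erase i, J j := by
  have hN : ∀ s, (p ^ expOrder p q) ^ s ≠ 0 := fun s =>
    pow_ne_zero _ (pow_ne_zero _ (Fact.out : p.Prime).ne_zero)
  have he := expOrder_pos hpe
  have hJ : ∀ k, ∃ x, Tendsto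
      (fun s => ((levelRow p q g s (linProd b) (cofProd b i * cofProd b k) l : unitBall K) : K))
      atTop (nhds x) := fun k =>
    exists_tendsto_of_norm_succ_sub_le hp1 fun s hs => unitBall.norm_le_of_dvd
      (levelRow_succ_sub_dvd hq hg hpe b hA (natDegree_cofProd_mul_cofProd b i k) hs l)
  choose J hJ using hJ
  have hM := tendsto_masterExp hp1 hq he
  refine ⟨J, fun k => ?_, fun k hk => ?_, ?_⟩
  · refine tendsto_nhds_unique ((hI i l).sub (hI k l)) (((hJ k).const_mul _).congr fun s => ?_)
    have h := congrFun (normalizedRow_C_mul (g := g) (hN s) (masterExp p q s) (linProd b)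
      (b i - b k) (cofProd b i * cofProd b k)) l
    -- Partial fractions in additive form: `(b_i - b_k) P_i P_k + F P_k = F P_i`.
    have h2 := congrFun (normalizedRow_add (g := g) (hN s) (masterExp p q s) (linProd b)
      (C (b i - b k) * (cofProd b i * cofProd b k)) (linProd b * cofProd b k)) l
    rw [← linProd_mul_cofProd_sub, sub_add_cancel, linProd_mul_cofProd_sub, Pi.add_apply, h] at h2
    have h3 := congrArg (Subtype.val) h2
    simp only [Pi.smul_apply, smul_eq_mul, Subring.coe_add, Subring.coe_mul, AddSubgroupClass.coe_sub] at h3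
    simp only [levelRow]
    rw [h3]; ring
  · have h := hI' i k l
    simp only [if_neg hk, Subring.coe_mul, zero_sub] at h
    refine tendsto_nhds_unique h ?_
    simpa using hM.neg.mul (hJ k)
  · have h := hI' i i l
    -- The class of the total derivative tends to zero; adding it to the row of index `i` cancels
    -- the `P_i P_i` term.
    have hz : Tendsto (fun s => (((masterExp p q s : unitBall K) *
        ∑ j ∈ Finset.univ.erase i, levelRow p q g s (linProd b) (cofProd b i * cofProd b j) l +
        ((masterExp p q s : unitBall K) - 1) *
          levelRow p q g s (linProd b) (cofProd b i * cofProd b i) l : unitBall K) : K))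
        atTop (nhds 0) := by
      refine squeeze_zero_norm' ?_ (tendsto_pow_atTop_nhds_zero_of_lt_one (norm_nonneg _) hp1)
      filter_upwards [eventually_ge_atTop 1] with s hs
      exact unitBall.norm_le_of_dvd ((pow_dvd_pow_expOrder he s).trans
        (dvd_normalizedRow_derivative (hN s) (two_le_masterExp hg hpe hs) b i l))
    have h2 := h.add hz
    rw [add_zero] at h2
    refine tendsto_nhds_unique h2 ?_
    have h3 := hM.mul (tendsto_finsetSum (Finset.univ.erase i) fun j _ => hJ j)
    refine h3.congr fun s => ?_
    simp only [if_true, ← Subring.coe_add]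
    have : ∀ x y z : unitBall K, (1 - x) * z + (x * y + (x - 1) * z) = x * y := fun x y z => by ring
    rw [this]
    simp

end Solutions

/-! ### The unramified extension -/

section Unramified

variable (p m : ℕ) [Fact p.Prime]

theorem UnramifiedExt.norm_natCast_lt_one : ‖(p : UnramifiedExt p m)‖ < 1 := by
  have h : ((p : UnramifiedExt p m) : PadicAlgCl p) = algebraMap ℚ_[p] (PadicAlgCl p) p := by simp
  change ‖((p : UnramifiedExt p m) : PadicAlgCl p)‖ < 1
  rw [h, norm_algebraMap']
  exact Padic.norm_p_lt_one

/-- For `m > 0` the adjoined roots of unity are finite in number, so the extension is finite over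
the complete field `ℚ_[p]`. -/
theorem UnramifiedExt.completeSpace (hm : 0 < m) : CompleteSpace (UnramifiedExt p m) := by
  have hpm : p ^ m - 1 ≠ 0 := by
    have := Nat.one_lt_pow hm.ne' (Fact.out : p.Prime).one_lt
    omega
  have hfin : Set.Finite {x : PadicAlgCl p | x ^ (p ^ m - 1) = 1} := by
    refine (Multiset.finite_toSet (nthRoots (p ^ m - 1) (1 : PadicAlgCl p))).subset fun x hx => ?_
    exact (mem_nthRoots (Nat.pos_of_ne_zero hpm)).2 hx
  have : Finite {x : PadicAlgCl p | x ^ (p ^ m - 1) = 1} := hfin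
  have : FiniteDimensional ℚ_[p] (UnramifiedExt p m) :=
    IntermediateField.finiteDimensional_adjoin fun x _ =>
      (Algebra.IsAlgebraic.isAlgebraic x).isIntegral
  exact FiniteDimensional.complete ℚ_[p] (UnramifiedExt p m)

end Unramified
-- The theorem
theorem mainTheorem8 (p q g n m : ℕ) [Fact p.Prime] (hq : q.Prime) (hpq : q < p)
    (hg : 0 < g) (hn : n = g * q + 1) (hpe : n < p ^ expOrder p q) (hpn : n + q ≤ p + 2)
    (hm : 0 < m) :
    ∃ (I : (Fin n → UnramifiedExt p m) → Matrix (Fin n) (Fin g) (UnramifiedExt p m))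
      (I' : Fin n → (Fin n → UnramifiedExt p m) → Matrix (Fin n) (Fin g) (UnramifiedExt p m)),
      -- `I` is the uniform limit of `I_s · A(Φ_s)⁻¹` on the domain
      TendstoUniformlyOn
        (fun (s : ℕ) (a : Fin n → UnramifiedExt p m) =>
          evalMatrix a (hypergeomSol n g p q s) * (evalMatrix a (hasseWitt n g p q s))⁻¹)
        I atTop (domainKZ n g p q m) ∧
      -- `I' i` is the uniform limit of `(∂I_s/∂z_i) · A(Φ_s)⁻¹` on the domain
      (∀ i, TendstoUniformlyOn
        (fun (s : ℕ) (a : Fin n → UnramifiedExt p m) =>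
          evalMatrix a (pderivMatrix i (hypergeomSol n g p q s)) *
            (evalMatrix a (hasseWitt n g p q s))⁻¹)
        (I' i) atTop (domainKZ n g p q m)) ∧
      -- the equation `I' i = H_i · I` away from the poles of `H_i`
      (∀ i, ∀ a ∈ domainKZ n g p q m, (∀ j, j ≠ i → a i ≠ a j) →
        I' i a = gaudinH q i a * I a) ∧
      -- the same equation, multiplied by `∏_{j ≠ i} (z_i - z_j)`, on the whole domain
      (∀ i, ∀ a ∈ domainKZ n g p q m,
        (∏ j ∈ Finset.univ.erase i, (a i - a j)) • I' i a =
          (q : UnramifiedExt p m)⁻¹ • ∑ j ∈ Finset.univ.erase i,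
            (∏ k ∈ (Finset.univ.erase i).erase j, (a i - a k)) •
              (Omega (UnramifiedExt p m) i j * I a)) := by

  subst hn
  have := UnramifiedExt.completeSpace p m hm
  have hp1 := UnramifiedExt.norm_natCast_lt_one p m
  have hlift := fun a (ha : a ∈ domainKZ (g * q + 1) g p q m) =>
    exists_lift_of_mem_domain hp1 hq.pos hpe ha.1 ha.2
  obtain ⟨I, hI⟩ := exists_tendstoUniformlyOn_matrix (norm_nonneg _) hp1
    (D := domainKZ (g * q + 1) g p q m)
    (y := fun s a => evalMatrix a (hypergeomSol (g * q + 1) g p q s) *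
      (evalMatrix a (hasseWitt (g * q + 1) g p q s))⁻¹) (by
      intro a ha s hs k l
      obtain ⟨b, rfl, hA⟩ := hlift a ha
      rw [solution_apply hq.pos hg hpe hs b (hA s hs),
        solution_apply hq.pos hg hpe (by omega) b (hA (s + 1) (by omega))]
      exact unitBall.norm_le_of_dvd (levelRow_succ_sub_dvd hq.pos hg hpe b hA
        (natDegree_linProd_mul_cofProd b k) hs l))
  have hex : ∀ i, ∃ I', TendstoUniformlyOn
      (fun (s : ℕ) (a : Fin (g * q + 1) → UnramifiedExt p m) =>
        evalMatrix a (pderivMatrix i (hypergeomSol (g * q + 1) g p q s)) *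
          (evalMatrix a (hasseWitt (g * q + 1) g p q s))⁻¹)
      I' atTop (domainKZ (g * q + 1) g p q m) := by
    intro i
    refine exists_tendstoUniformlyOn_matrix (norm_nonneg _) hp1 ?_
    intro a ha s hs k l
    obtain ⟨b, rfl, hA⟩ := hlift a ha
    rw [pderiv_solution_apply hq.pos hg hpe hs b (hA s hs),
      pderiv_solution_apply hq.pos hg hpe (by omega) b (hA (s + 1) (by omega))]
    exact unitBall.norm_le_of_dvd (masterExp_mul_levelRow_succ_sub_dvd hq.pos hg hpe b hA
      (natDegree_cofProd_mul_cofProd b i k) hs l _)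
  choose I' hI' using hex
  have hkz := fun i a (ha : a ∈ domainKZ (g * q + 1) g p q m) =>
    kz_of_relations (q := q) (I := I a) (I' := I' i a) (a := a) (i := i) (by
      obtain ⟨b, rfl, hA⟩ := hlift a ha
      refine exists_limit_relations (I' := fun i => I' i _) hp1 hq.pos hg hpe b hA ?_ ?_ i
      · intro k l
        refine ((tendsto_pi_nhds.1 (tendsto_pi_nhds.1 (hI.tendsto_at ha) k) l)).congr' ?_
        -- The description by normalized rows is available for `s ≥ 1`, which suffices for the
        -- limit.
        filter_upwards [eventually_ge_atTop 1] with s hs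
        exact solution_apply hq.pos hg hpe hs b (hA s hs) k l
      · intro i k l
        refine ((tendsto_pi_nhds.1 (tendsto_pi_nhds.1 ((hI' i).tendsto_at ha) k) l)).congr' ?_
        filter_upwards [eventually_ge_atTop 1] with s hs
        exact pderiv_solution_apply hq.pos hg hpe hs b (hA s hs) i k l)
  exact ⟨I, I', hI, hI', fun i a ha => (hkz i a ha).1, fun i a ha => (hkz i a ha).2⟩
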